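/- **Setting.** Let $1\le K\le N$ be integers and let $\mathcal S$ be the collection of all $S\subseteq[N]$ with $1\le|S|\le K$. For $S\in\mathcal S$ and $v\in[0,1]^N$ let $\mu(S,v)$ be the multinomial logit distribution on $\{0,1,\dots,N\}$: $\mu_i(S,v)=\frac{v_i}{1+\sum_{j\in S}v_j}$ for $i\in S$, $\mu_0(S,v)=\frac{1}{1+\sum_{j\in S}v_j}$, and $\mu_i(S,v)=0$ otherwise. The log loss is $\ell_{\log}(\mu,i)=-\log\mu_i$. Let $\mathcal X$ be a measurable context space and $\mathcal F$ a non-empty class of measurable functions $f:\mathcal X\to[0,1]^N$. A distribution $\mathcal H$ of $(x,S,i)\in\mathcal X\times\mathcal S\times\{0,\dots,N\}$ *follows* $f^\star$ if under $\mathcal H$ the conditional distribution of $i$ given $(x,S)$ is $\mu(S,f^\star(x))$. An algorithm that maps each data set $D$ of $n$ samples to a function $\widehat f_D\in\mathcal F$ *satisfies the offline oracle assumption with error* $\mathbf{Err}(n,\delta)$ if $\mathbf{Err}$ is non-increasing in $n$ and, for every $f^\star\in\mathcal F$, every $\mathcal H$ that follows $f^\star$, every $n\ge1$ and $\delta\in(0,1)$,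 with probability at least $1-\delta$ over $n$ i.i.d. samples $D$ from $\mathcal H$, $$\mathbb E_{(x,S,i)\sim\mathcal H}\big[\ell_{\log}(\mu(S,\widehat f_D(x)),i)-\ell_{\log}(\mu(S,f^\star(x)),i)\big]\le\mathbf{Err}(n,\delta).$$ Empirical risk minimization (ERM) outputs any $\widehat f_D\in\operatorname{argmin}_{f\in\mathcal F}\sum_{(x,S,i)\in D}\ell_{\log}(\mu(S,f(x)),i)$. **Lemma.** There is a universal constant $C>0$ such that in the following two cases a minimizer exists for every data set, and ERM, with any choice among the minimizers, satisfies the offline oracle assumption with the stated error. * (Finite class) $\mathcal F$ is finite and its members have image in $[\beta,1]^N$ for some $\beta\in(0,1)$, with $$\mathbf{Err}(n,\delta)=C\,\frac{\max\{1,\log\frac K\beta\}\,\log\frac{|\mathcal F|}\delta}{n}.$$ * (Linear class) $\mathcal X\subseteq\{x=(x_1,\dots,x_N)\in\mathbb R^{d\times N}:\|x_i\|_2\le1\ \forall i\in[N]\}$ and, for some $B>0$, $\mathcal F=\{f_\theta:\theta\in\mathbb R^d,\ \|\theta\|_2\le B\}$ with $f_{\theta,i}(x)=e^{\theta^\top x_i-B}$,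 and $$\mathbf{Err}(n,\delta)=C\,\frac{d\,\max\{1,B\}\,\max\{1,\log K\}\,\max\{1,\log B\}\,\max\{1,\log\frac1\delta\}}{n}.$$ Moreover, in both cases every $\mathcal H$ that follows some $f^\star\in\mathcal F$ satisfies the strong $1$-central condition: there is $f_0\in\mathcal F$ such that for all $f\in\mathcal F$ $$\mathbb E_{(x,S,i)\sim\mathcal H}\big[\exp\big(\ell_{\log}(\mu(S,f_0(x)),i)-\ell_{\log}(\mu(S,f(x)),i)\big)\big]\le1.$$ -/

import Mathlib

open MeasureTheory

noncomputable section

namespace MNL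

/-- The collection `𝒮` of all assortments: subsets of the `N` items with at least `1` and at most
`K` elements. -/
def Assortment (N K : ℕ) : Type :=
  {S : Finset (Fin N) // 1 ≤ S.card ∧ S.card ≤ K}

/-- The finite set of assortments carries the discrete σ-algebra. -/
instance instMeasurableSpaceAssortment (N K : ℕ) : MeasurableSpace (Assortment N K) := ⊤

/-- The multinomial logit distribution `μ(S, v)` on the outcomes `{0, 1, …, N}`. The outcome `0` is
"no purchase" (with value `1`), and the outcome `j.succ` is the purchase of the item `j : Fin N`. -/
def mnlProb {N : ℕ} (S : Finset (Fin N)) (v : Fin N → ℝ) (i : Fin (N + 1)) : ℝ :=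
  Fin.cases (motive := fun _ => ℝ) 1 (fun j => if j ∈ S then v j else 0) i / (1 + ∑ j ∈ S, v j)

/-- A sample `((x, S), i)`: a context, an assortment and a purchase decision. -/
abbrev Sample (X : Type*) (N K : ℕ) : Type _ := (X × Assortment N K) × Fin (N + 1)

/-- The log loss `-log μ_i(S, f(x))` of the value function `f` on the sample `((x, S), i)`.
It is only used for value functions with positive values. For those the probability is positive for
every outcome `i` in `S ∪ {0}`, and outcomes outside `S ∪ {0}` have probability zero under every
distribution that follows the model. -/
def logLoss {X : Type*} {N K : ℕ} (f : X → Fin N → ℝ) (z : Sample X N K) : ℝ :=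
  -Real.log (mnlProb z.1.2.1 (f z.1.1) z.2)

/-- Under `H`, the conditional distribution of the purchase decision `i` given `(x, S)` is
`μ(S, f(x))`. -/
def FollowsMNL {X : Type*} [MeasurableSpace X] {N K : ℕ}
    (H : Measure (Sample X N K)) (f : X → Fin N → ℝ) : Prop :=
  ∀ (i : Fin (N + 1)) (A : Set (X × Assortment N K)), MeasurableSet A →
    H (A ×ˢ {i}) = ∫⁻ p in A, ENNReal.ofReal (mnlProb p.2.1 (f p.1) i) ∂H.fst

/-- A regression algorithm maps each data set of any size `n` to a value function. -/
abbrev RegressionAlg (X : Type*) (N K : ℕ) : Type _ :=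
  (n : ℕ) → (Fin n → Sample X N K) → X → Fin N → ℝ

/-- `alg` is an empirical log-loss minimizer over `F`: on each data set it outputs a minimizer over
`F` of the total log loss (ties are broken arbitrarily). -/
def IsERM {X : Type*} {N K : ℕ} (F : Set (X → Fin N → ℝ)) (alg : RegressionAlg X N K) : Prop :=
  ∀ (n : ℕ) (D : Fin n → Sample X N K),
    alg n D ∈ F ∧ ∀ f ∈ F, ∑ k, logLoss (alg n D) (D k) ≤ ∑ k, logLoss f (D k)

/-- The offline oracle assumption with error function `Err n δ`: the error function is
non-increasing in the sample size, and for every distribution `H` of samples that follows the MNL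
model of some `fstar ∈ F`, with probability at least `1 - δ` over `n` i.i.d. samples from `H` the
output is a member of `F` whose expected excess log loss exists and is at most `Err n δ`. -/
def OfflineOracle {X : Type*} [MeasurableSpace X] {N K : ℕ} (F : Set (X → Fin N → ℝ))
    (alg : RegressionAlg X N K) (Err : ℕ → ℝ → ℝ) : Prop :=
  (∀ δ : ℝ, 0 < δ → δ < 1 → AntitoneOn (fun n => Err n δ) (Set.Ici 1)) ∧
  ∀ (H : Measure (Sample X N K)), IsProbabilityMeasure H →
    ∀ fstar ∈ F, FollowsMNL H fstar →
      ∀ (n : ℕ), 1 ≤ n → ∀ δ : ℝ, 0 < δ → δ < 1 →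
        ∃ G : Set (Fin n → Sample X N K), MeasurableSet G ∧
          ENNReal.ofReal (1 - δ) ≤ Measure.pi (fun _ : Fin n => H) G ∧
          ∀ D ∈ G, alg n D ∈ F ∧
            Integrable (fun z => logLoss (alg n D) z - logLoss fstar z) H ∧
            ∫ z, (logLoss (alg n D) z - logLoss fstar z) ∂H ≤ Err n δ

/-- The strong `η`-central condition for the log loss, the class `F` and the distribution `H`. -/
def StrongCentral {X : Type*} [MeasurableSpace X] {N K : ℕ} (η : ℝ) (F : Set (X → Fin N → ℝ))
    (H : Measure (Sample X N K)) : Prop :=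
  ∃ f₀ ∈ F, ∀ f ∈ F,
    Integrable (fun z => Real.exp (η * (logLoss f₀ z - logLoss f z))) H ∧
    ∫ z, Real.exp (η * (logLoss f₀ z - logLoss f z)) ∂H ≤ 1

/-- The linear class `{f_θ : ‖θ‖₂ ≤ B}` with `f_{θ,i}(x) = exp(θᵀ x_i - B)`, on a set `𝒳` of
contexts `x = (x_1, …, x_N)` with columns `x_i` in `ℝ^d`. -/
def linearClass {N d : ℕ} (𝒳 : Set (Fin N → EuclideanSpace ℝ (Fin d))) (B : ℝ) :
    Set (𝒳 → Fin N → ℝ) :=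
  {f | ∃ θ : EuclideanSpace ℝ (Fin d), ‖θ‖ ≤ B ∧
    f = fun x i => Real.exp (inner ℝ θ (x.1 i) - B)}

/-- The error function for a finite class with `M` members. -/
def finiteErr (C : ℝ) (K : ℕ) (β : ℝ) (M : ℕ) (n : ℕ) (δ : ℝ) : ℝ :=
  C * (max 1 (Real.log (K / β)) * Real.log (M / δ)) / n

/-- The error function for the linear class. -/
def linearErr (C : ℝ) (d K : ℕ) (B : ℝ) (n : ℕ) (δ : ℝ) : ℝ :=
  C * (d * max 1 B * max 1 (Real.log K) * max 1 (Real.log B) * max 1 (Real.log (1 / δ))) / n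

end MNL

end

noncomputable section

namespace MNL

/-! For `f` in the class let `y_f` be the log-likelihood ratio of `f` to the true `fstar`. Then `E
exp y_f = 1`, which is already the strong 1-central condition with equality. The excess risk `R(f) =
E[-y_f]` is a relative entropy. Values in `[β, 1]` give `|y_f| ≤ L = 2 log (1/β)`. For bounded
ratios relative entropy is at most a constant `c` of order `max 1 L` times the squared Hellinger
distance, so `E exp (½ ∑ y_f) ≤ exp (-n R(f) / (2c))` (`integral_exp_half_le`). The empirical
minimizer has `∑ y_f ≥ 0`. For a finite class, Markov's inequality for the sum of these exponential
moments over the class finishes the proof (`exists_event_finite_class`). For the linear class the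
sum is replaced by Lebesgue integrals over the parameter ball `Θ`, so neither a covering nor a
factor `log n` appears (`exists_event_concave_class`). To pass from an integral to one minimizer
`θ`, `Θ` is shrunk towards `θ` by the factor `α = 1/(10c)`. The empirical ratio is concave in the
parameter, so on the shrunken copy it is at least `α ∑ y_u`. The risk there is at least `½ R(θ) - ½
R(u)`, because a convex combination of parameters is a normalized geometric mixture of choice
distributions, whose normalizer is controlled by the two relative entropies
(`geometricMixture_logNormalizer_le`). The remaining integral of `exp (α/2 ∑ y_u - n R(u)/(8c))` is
bounded below by a second Markov bound, using `E exp (-a y) ≤ exp (12 R)`, and by convexity of the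
risk around the true parameter. The two changes of scale cost only `d log (520 c²)`. The argument
never produces `log K`; this factor in the stated errors is slack. -/

/-! ### Scalar inequalities behind the Hellinger comparisons. -/

/-- Averaged over a log-likelihood ratio `t`, this bounds relative entropy by `c` times squared
Hellinger distance. With `s = exp (t/2)`, the bound `log s ≥ 1 - 1/s` gives the factor `1 + 2/s ≤ 5`
when `s ≥ 1/2`. For smaller `s` the square is at least `1/4` while the left side is at most `L ≤
c/4`. -/
theorem exp_sub_one_sub_le_sq {t L c : ℝ} (ht : -t ≤ L) (hc : 5 ≤ c) (hcL : 4 * L ≤ c) :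
    Real.exp t - 1 - t ≤ c * (1 - Real.exp (t / 2)) ^ 2 := by
  set s := Real.exp (t / 2) with hs
  have hs0 : 0 < s := Real.exp_pos _
  have hst : Real.exp t = s ^ 2 := by rw [hs, ← Real.exp_nat_mul]; congr 1; push_cast; ring
  have hlog : Real.log s = t / 2 := Real.log_exp _
  rw [hst]
  by_cases h : 1 / 2 ≤ s
  · have h1 : 1 - s⁻¹ ≤ t / 2 := hlog ▸ Real.one_sub_inv_le_log_of_pos hs0
    have h2 : s * s⁻¹ = 1 := mul_inv_cancel₀ hs0.ne'
    have h3 : s⁻¹ ≤ 2 := by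
      rw [inv_le_comm₀ hs0 two_pos]; linarith
    have h4 : s ^ 2 - 1 - t ≤ (1 - s) ^ 2 * (1 + 2 * s⁻¹) := by
      have : (1 - s) ^ 2 * (1 + 2 * s⁻¹) =
        (1 - s) ^ 2 + 2 * s⁻¹ - 4 * (s * s⁻¹) + 2 * s * (s * s⁻¹) := by ring
      rw [this, h2]; nlinarith
    nlinarith [sq_nonneg (1 - s), mul_nonneg (sq_nonneg (1 - s)) (sub_nonneg.2 h3),
      mul_nonneg (sq_nonneg (1 - s)) (sub_nonneg.2 hc)]
  · push Not at h
    have h1 : (1 / 4 : ℝ) ≤ (1 - s) ^ 2 := by nlinarith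
    have h2 : c * (1 / 4) ≤ c * (1 - s) ^ 2 := by gcongr
    nlinarith

/-- Used for negative exponential moments; the term `a (exp t - 1)` has mean zero for a
log-likelihood ratio. For `s = exp (t/2) ≥ 1/2`, convexity in `a` reduces to `(s - 1/s)² ≤ 9 (1 -
s)²`; otherwise the left side is below `e - 1 < 3 ≤ 12 (1 - s)²`. -/
theorem exp_neg_mul_le_sq {t L a : ℝ} (ht : -t ≤ L) (ha : 0 ≤ a) (ha1 : a ≤ 1)
    (haL : a * L ≤ 1) :
    Real.exp (-(a * t)) - 1 + a * (Real.exp t - 1) ≤ 12 * (1 - Real.exp (t / 2)) ^ 2 := by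
  set s := Real.exp (t / 2) with hs
  have hs0 : 0 < s := Real.exp_pos _
  have hst : Real.exp t = s ^ 2 := by rw [hs, ← Real.exp_nat_mul]; congr 1; push_cast; ring
  have hst' : Real.exp (-t) = (s⁻¹) ^ 2 := by rw [Real.exp_neg, hst, inv_pow]
  rw [hst]
  have h2 : s * s⁻¹ = 1 := mul_inv_cancel₀ hs0.ne'
  by_cases h : 1 / 2 ≤ s
  · have h3 : s⁻¹ ≤ 2 := by
      rw [inv_le_comm₀ hs0 two_pos]; linarith
    have h0 : 0 < s⁻¹ := inv_pos.2 hs0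
    have hcv : Real.exp (-(a * t)) ≤ (1 - a) + a * (s⁻¹) ^ 2 := by
      have := convexOn_exp.2 (Set.mem_univ 0) (Set.mem_univ (-t)) (sub_nonneg.2 ha1) ha
        (by ring)
      simp only [smul_eq_mul, mul_zero, zero_add, Real.exp_zero, mul_one, hst'] at this
      rwa [mul_neg] at this
    have h4 : s ^ 2 + (s⁻¹) ^ 2 - 2 = (1 - s) ^ 2 * (1 + s⁻¹) ^ 2 := by
      have : (1 - s) ^ 2 * (1 + s⁻¹) ^ 2 = (1 + s⁻¹ - s - s * s⁻¹) ^ 2 := by ring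
      rw [this, h2]; linear_combination 2 * h2
    have h5 : (1 + s⁻¹) ^ 2 ≤ 9 := by nlinarith
    have h6 : (1 - s) ^ 2 * (1 + s⁻¹) ^ 2 ≤ (1 - s) ^ 2 * 9 := by gcongr
    have h7 : a * ((1 - s) ^ 2 * (1 + s⁻¹) ^ 2) ≤ 1 * ((1 - s) ^ 2 * 9) := by gcongr
    rw [← h4] at h7
    nlinarith [sq_nonneg (1 - s)]
  · push Not at h
    have h1 : (1 / 4 : ℝ) ≤ (1 - s) ^ 2 := by nlinarith
    have h3 : Real.exp (-(a * t)) ≤ Real.exp 1 := by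
      apply Real.exp_le_exp.2; nlinarith
    have h4 := Real.exp_one_lt_d9
    nlinarith

/-! ### Hellinger distance, relative entropy and geometric mixtures on a finite set. -/

section FiniteDistribution

variable {ι : Type*} (s : Finset ι) {a b g : ι → ℝ} {t κ : ℝ}

/-- Squared Hellinger distance is at most relative entropy: `exp x ≥ 1 + x` at half the log ratio,
where the total masses cancel. -/
theorem sum_sq_exp_half_sub_le (ha : ∑ i ∈ s, Real.exp (a i) = 1)
    (hb : ∑ i ∈ s, Real.exp (b i) = 1) :
    ∑ i ∈ s, (Real.exp (b i / 2) - Real.exp (a i / 2)) ^ 2 ≤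
      ∑ i ∈ s, Real.exp (a i) * (a i - b i) := by
  have key : ∀ i ∈ s, (Real.exp (b i / 2) - Real.exp (a i / 2)) ^ 2 ≤
      Real.exp (a i) * (a i - b i) + Real.exp (b i) - Real.exp (a i) := by
    intro i _
    have h1 : Real.exp (b i) = Real.exp (b i / 2) ^ 2 := by
      rw [← Real.exp_nat_mul]; congr 1; push_cast; ring
    have h2 : Real.exp (a i) = Real.exp (a i / 2) ^ 2 := by
      rw [← Real.exp_nat_mul]; congr 1; push_cast; ring
    have h3 : Real.exp (b i / 2) = Real.exp (a i / 2) * Real.exp (b i / 2 - a i / 2) := by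
      rw [← Real.exp_add]; congr 1; ring
    have h4 := Real.add_one_le_exp (b i / 2 - a i / 2)
    have h5 : Real.exp (a i / 2) ^ 2 * (b i / 2 - a i / 2 + 1) ≤
        Real.exp (a i / 2) ^ 2 * Real.exp (b i / 2 - a i / 2) := by gcongr
    have h6 : Real.exp (a i / 2) ^ 2 * Real.exp (b i / 2 - a i / 2) =
        Real.exp (a i / 2) * Real.exp (b i / 2) := by rw [h3]; ring
    rw [h1, h2]; nlinarith
  have := Finset.sum_le_sum key
  rw [Finset.sum_sub_distrib, Finset.sum_add_distrib, ha, hb] at this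
  linarith

/-- The normalizing constant of a geometric mixture of two distributions is at least one. -/
theorem geometricMixture_logNormalizer_nonneg (hb : ∑ i ∈ s, Real.exp (b i) = 1)
    (hg : ∑ i ∈ s, Real.exp (g i) = 1) (ht : 0 ≤ t) (ht1 : t ≤ 1)
    (hm : ∑ i ∈ s, Real.exp ((1 - t) * b i + t * g i + κ) = 1) : 0 ≤ κ := by
  have h1 : ∑ i ∈ s, Real.exp ((1 - t) * b i + t * g i) ≤ 1 := by
    calc ∑ i ∈ s, Real.exp ((1 - t) * b i + t * g i)
        ≤ ∑ i ∈ s, ((1 - t) * Real.exp (b i) + t * Real.exp (g i)) := by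
          refine Finset.sum_le_sum fun i _ => ?_
          exact convexOn_exp.2 (Set.mem_univ _) (Set.mem_univ _) (sub_nonneg.2 ht1) ht (by ring)
      _ = 1 := by
          rw [Finset.sum_add_distrib, ← Finset.mul_sum, ← Finset.mul_sum, hb, hg]; ring
  simp_rw [Real.exp_add _ κ] at hm
  rw [← Finset.sum_mul] at hm
  by_contra hk
  have h2 : Real.exp κ < 1 := Real.exp_lt_one_iff.2 (not_le.1 hk)
  have h3 := Real.exp_pos κ
  nlinarith

/-- The normalizing constant of a geometric mixture of `q = exp b` and `r = exp g` is controlled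
by the relative entropies of `q` and `r` with respect to a third distribution `p = exp a`. -/
theorem geometricMixture_logNormalizer_le {L c : ℝ} (ha : ∑ i ∈ s, Real.exp (a i) = 1)
    (hb : ∑ i ∈ s, Real.exp (b i) = 1) (hg : ∑ i ∈ s, Real.exp (g i) = 1)
    (hL : ∀ i ∈ s, b i - g i ≤ L) (hc : 5 ≤ c) (hcL : 4 * L ≤ c) (ht : t = 1 / (10 * c))
    (hm : ∑ i ∈ s, Real.exp ((1 - t) * b i + t * g i + κ) = 1) :
    κ ≤ 2 / 5 * (∑ i ∈ s, Real.exp (a i) * (a i - b i) +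
      ∑ i ∈ s, Real.exp (a i) * (a i - g i)) := by
  have htc : t * c = 1 / 10 := by rw [ht]; field_simp
  have ht0 : 0 ≤ t := by rw [ht]; positivity
  set Z := ∑ i ∈ s, Real.exp ((1 - t) * b i + t * g i) with hZ
  have hZκ : Z * Real.exp κ = 1 := by
    have := hm
    simp_rw [Real.exp_add _ κ] at this
    rwa [← Finset.sum_mul] at this
  have hsq : ∀ x : ℝ, Real.exp x = Real.exp (x / 2) ^ 2 := fun x => by
    rw [← Real.exp_nat_mul]; congr 1; push_cast; ring
  -- With `x = g - b`, use `1 - exp (t x) ≤ -t x` and bound `-x` by `c (1 - exp (x/2))² + 1 - exp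
  -- x`. The terms linear in the masses cancel after summation, and `t c = 1/10`.
  have h1 : 1 - Z ≤ 1 / 10 * ∑ i ∈ s, (Real.exp (b i / 2) - Real.exp (g i / 2)) ^ 2 := by
    have key : ∀ i ∈ s, Real.exp (b i) - Real.exp ((1 - t) * b i + t * g i) ≤
        1 / 10 * (Real.exp (b i / 2) - Real.exp (g i / 2)) ^ 2 + t * Real.exp (b i)
          - t * Real.exp (g i) := by
      intro i hi
      have e1 : Real.exp ((1 - t) * b i + t * g i) =
          Real.exp (b i) * Real.exp (t * (g i - b i)) := by rw [← Real.exp_add]; congr 1; ring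
      have e2 : Real.exp (g i) = Real.exp (b i) * Real.exp (g i - b i) := by
        rw [← Real.exp_add]; congr 1; ring
      have e3 : Real.exp (g i / 2) = Real.exp (b i / 2) * Real.exp ((g i - b i) / 2) := by
        rw [← Real.exp_add]; congr 1; ring
      have h2 := exp_sub_one_sub_le_sq (t := g i - b i) (by linarith [hL i hi]) hc hcL
      have h3 := Real.add_one_le_exp (t * (g i - b i))
      have h4 := mul_le_mul_of_nonneg_left h2 ht0
      rw [← mul_assoc, htc] at h4
      have h5 : 1 - Real.exp (t * (g i - b i)) ≤
        1 / 10 * (1 - Real.exp ((g i - b i) / 2)) ^ 2 + t - t * Real.exp (g i - b i) := by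
        linarith
      have h6 := mul_le_mul_of_nonneg_left h5 (Real.exp_pos (b i)).le
      rw [e1, e2, e3]
      have e4 := hsq (b i)
      calc _ = Real.exp (b i) * (1 - Real.exp (t * (g i - b i))) := by ring
        _ ≤ _ := h6
        _ = _ := by rw [e4]; ring
    have := Finset.sum_le_sum key
    simp only [Finset.sum_sub_distrib, Finset.sum_add_distrib, ← Finset.mul_sum, hb, hg] at this
    linarith
  have h2 : ∑ i ∈ s, (Real.exp (b i / 2) - Real.exp (g i / 2)) ^ 2 ≤
      2 * (∑ i ∈ s, Real.exp (a i) * (a i - b i) + ∑ i ∈ s, Real.exp (a i) * (a i - g i)) := by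
    have h3 := sum_sq_exp_half_sub_le s ha hb
    have h4 := sum_sq_exp_half_sub_le s ha hg
    have h5 : ∑ i ∈ s, (Real.exp (b i / 2) - Real.exp (g i / 2)) ^ 2 ≤
        2 * (∑ i ∈ s, (Real.exp (b i / 2) - Real.exp (a i / 2)) ^ 2 +
          ∑ i ∈ s, (Real.exp (g i / 2) - Real.exp (a i / 2)) ^ 2) := by
      rw [← Finset.sum_add_distrib, Finset.mul_sum]
      refine Finset.sum_le_sum fun i _ => ?_
      nlinarith [sq_nonneg (Real.exp (b i / 2) + Real.exp (g i / 2) - 2 * Real.exp (a i / 2))]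
    linarith
  -- A squared Hellinger distance is at most `2`, so `Z ≥ 4/5`; this keeps `1/Z - 1` below `2 (1 -
  -- Z)`.
  have h3 : ∑ i ∈ s, (Real.exp (b i / 2) - Real.exp (g i / 2)) ^ 2 ≤ 2 := by
    have : ∑ i ∈ s, (Real.exp (b i / 2) - Real.exp (g i / 2)) ^ 2 ≤
        ∑ i ∈ s, (Real.exp (b i) + Real.exp (g i)) := by
      refine Finset.sum_le_sum fun i _ => ?_
      rw [hsq (b i), hsq (g i)]
      nlinarith [mul_pos (Real.exp_pos (b i / 2)) (Real.exp_pos (g i / 2))]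
    rw [Finset.sum_add_distrib, hb, hg] at this
    linarith
  have hZ0 : 0 < Z := by linarith
  have h4 : κ ≤ Z⁻¹ - 1 := by
    have : Real.exp κ = Z⁻¹ := by field_simp; linarith
    linarith [Real.add_one_le_exp κ]
  have h5 : Z⁻¹ - 1 ≤ 2 * (1 - Z) := by
    by_cases h1Z : Z ≤ 1
    · rw [sub_le_iff_le_add, inv_le_iff_one_le_mul₀ hZ0]; nlinarith
    · exfalso
      have h0 := geometricMixture_logNormalizer_nonneg s hb hg ht0
        (by rw [ht, div_le_one (by linarith)]; linarith) hm
      have := Real.one_le_exp h0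
      nlinarith
  linarith

end FiniteDistribution

/-! ### Markov's inequality and exponential moments of log-likelihood ratios. -/

theorem ofReal_one_sub_le_measure_of_lintegral_le {Ω : Type*} [MeasurableSpace Ω] {μ : Measure Ω}
    [IsProbabilityMeasure μ] {W : Ω → ENNReal} (hW : Measurable W) {A δ : ℝ} (hA : 0 < A)
    (hδ : 0 < δ) (h : ∫⁻ ω, W ω ∂μ ≤ ENNReal.ofReal A) :
    ENNReal.ofReal (1 - δ) ≤ μ {ω | W ω ≤ ENNReal.ofReal (A / δ)} := by
  have hm : MeasurableSet {ω | W ω ≤ ENNReal.ofReal (A / δ)} := measurableSet_le hW measurable_const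
  have hc : μ {ω | W ω ≤ ENNReal.ofReal (A / δ)}ᶜ ≤ ENNReal.ofReal δ := by
    calc μ {ω | W ω ≤ ENNReal.ofReal (A / δ)}ᶜ ≤ μ {ω | ENNReal.ofReal (A / δ) ≤ W ω} := by
          refine measure_mono fun ω hω => ?_
          simp only [Set.mem_compl_iff, Set.mem_ofPred_eq, not_le] at hω ⊢
          exact hω.le
      _ ≤ (∫⁻ ω, W ω ∂μ) / ENNReal.ofReal (A / δ) :=
          meas_ge_le_lintegral_div hW.aemeasurable (by simp; positivity) ENNReal.ofReal_ne_top
      _ ≤ ENNReal.ofReal A / ENNReal.ofReal (A / δ) := by gcongr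
      _ = ENNReal.ofReal δ := by
          rw [← ENNReal.ofReal_div_of_pos (by positivity)]
          congr 1; field_simp
  have h1 := prob_compl_eq_one_sub (μ := μ) hm
  have h2 : μ {ω | W ω ≤ ENNReal.ofReal (A / δ)} = 1 - μ {ω | W ω ≤ ENNReal.ofReal (A / δ)}ᶜ := by
    rw [← prob_compl_eq_one_sub hm.compl, compl_compl]
  rw [h2, ENNReal.ofReal_sub _ hδ.le, ENNReal.ofReal_one]
  gcongr

/-- A bounded measurable function `y` is a log-likelihood ratio with respect to `H` if `exp y`
is a probability density. -/
structure IsLogRatio {Z : Type*} [MeasurableSpace Z] (H : Measure Z) (L : ℝ) (y : Z → ℝ) :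
    Prop where
  measurable : Measurable y
  abs_le : ∀ z, |y z| ≤ L
  integral_exp : ∫ z, Real.exp (y z) ∂H = 1

namespace IsLogRatio

variable {Z : Type*} [MeasurableSpace Z] {H : Measure Z} [IsProbabilityMeasure H] {L c : ℝ}
  {y : Z → ℝ}

theorem integrable (h : IsLogRatio H L y) : Integrable y H :=
  Integrable.of_bound h.measurable.aestronglyMeasurable L (.of_forall h.abs_le)

theorem integrable_exp_mul (h : IsLogRatio H L y) (a : ℝ) :
    Integrable (fun z => Real.exp (a * y z)) H := by
  refine Integrable.of_bound (C := Real.exp (|a| * L))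
    (h.measurable.const_mul a).exp.aestronglyMeasurable (.of_forall fun z => ?_)
  rw [Real.norm_eq_abs, Real.abs_exp]
  apply Real.exp_le_exp.2
  calc a * y z ≤ |a * y z| := le_abs_self _
    _ = |a| * |y z| := abs_mul _ _
    _ ≤ |a| * L := by gcongr; exact h.abs_le z

theorem integrable_exp (h : IsLogRatio H L y) : Integrable (fun z => Real.exp (y z)) H := by
  simpa using h.integrable_exp_mul 1

theorem integrable_exp_half (h : IsLogRatio H L y) :
    Integrable (fun z => Real.exp (y z / 2)) H := by
  simpa [div_eq_inv_mul] using h.integrable_exp_mul (1 / 2)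

theorem sq_one_sub_exp_half (t : ℝ) :
    (1 - Real.exp (t / 2)) ^ 2 = 1 - 2 * Real.exp (t / 2) + Real.exp t := by
  have : Real.exp t = Real.exp (t / 2) ^ 2 := by
    rw [← Real.exp_nat_mul]; congr 1; push_cast; ring
  rw [this]; ring

theorem integral_sq (h : IsLogRatio H L y) :
    ∫ z, (1 - Real.exp (y z / 2)) ^ 2 ∂H = 2 - 2 * ∫ z, Real.exp (y z / 2) ∂H := by
  simp_rw [sq_one_sub_exp_half]
  have hi : Integrable (fun z => 1 - 2 * Real.exp (y z / 2)) H :=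
    (integrable_const _).sub (h.integrable_exp_half.const_mul 2)
  rw [integral_add hi h.integrable_exp,
    integral_sub (integrable_const _) (h.integrable_exp_half.const_mul 2), h.integral_exp,
    integral_const_mul]
  simp; ring

theorem integrable_sq (h : IsLogRatio H L y) :
    Integrable (fun z => (1 - Real.exp (y z / 2)) ^ 2) H := by
  simp_rw [sq_one_sub_exp_half]
  exact ((integrable_const _).sub (h.integrable_exp_half.const_mul 2)).add h.integrable_exp

/-- The relative entropy is nonnegative and dominates the squared Hellinger distance. -/
theorem integral_sq_le (h : IsLogRatio H L y) :
    ∫ z, (1 - Real.exp (y z / 2)) ^ 2 ∂H ≤ ∫ z, -y z ∂H := by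
  rw [h.integral_sq]
  have h1 : ∫ z, (2 * (1 - Real.exp (y z / 2))) ∂H ≤ ∫ z, -y z ∂H := by
    refine integral_mono (((integrable_const _).sub h.integrable_exp_half).const_mul 2)
      h.integrable.neg fun z => ?_
    have := Real.add_one_le_exp (y z / 2)
    linarith
  rw [integral_const_mul, integral_sub (integrable_const _) h.integrable_exp_half] at h1
  simp at h1 ⊢
  linarith

theorem risk_nonneg (h : IsLogRatio H L y) : 0 ≤ ∫ z, -y z ∂H :=
  (integral_nonneg fun _ => sq_nonneg _).trans h.integral_sq_le

/-- Since `exp y - 1` has mean zero, the scalar inequality gives risk at most `c` times squared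
Hellinger distance, which is `2 - 2 E exp (y/2)`. -/
theorem integral_exp_half_le (h : IsLogRatio H L y) (hc : 5 ≤ c) (hcL : 4 * L ≤ c) :
    ∫ z, Real.exp (y z / 2) ∂H ≤ Real.exp (-(∫ z, -y z ∂H) / (2 * c)) := by
  have hi : Integrable (fun z => Real.exp (y z) - 1) H := h.integrable_exp.sub (integrable_const _)
  have hn : Integrable (fun z => -y z) H := h.integrable.neg
  have h1 : ∫ z, (Real.exp (y z) - 1 + -y z) ∂H ≤ ∫ z, c * (1 - Real.exp (y z / 2)) ^ 2 ∂H := by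
    refine integral_mono (hi.add hn)
      (h.integrable_sq.const_mul c) fun z => ?_
    have := exp_sub_one_sub_le_sq (t := y z) ((neg_le_abs _).trans (h.abs_le z)) hc hcL
    simpa [sub_eq_add_neg] using this
  rw [integral_add hi hn,
    integral_sub h.integrable_exp (integrable_const _), h.integral_exp, integral_const_mul,
    h.integral_sq] at h1
  simp only [integral_const, probReal_univ, smul_eq_mul, mul_one, sub_self, zero_add] at h1
  have h2 := Real.add_one_le_exp (-(∫ z, -y z ∂H) / (2 * c))
  refine le_trans ?_ h2
  have h3 : (∫ z, -y z ∂H) / (2 * c) ≤ 1 - ∫ z, Real.exp (y z / 2) ∂H := by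
    rw [div_le_iff₀ (by linarith)]; linarith
  rw [neg_div]; linarith

/-- The converse control: it stops the empirical ratio from being too negative. The small exponent
`a`, of order `1/L`, makes the bound depend on the risk alone and not on `L`. -/
theorem integral_exp_neg_mul_le (h : IsLogRatio H L y) {a : ℝ} (ha : 0 ≤ a) (ha1 : a ≤ 1)
    (haL : a * L ≤ 1) :
    ∫ z, Real.exp (-a * y z) ∂H ≤ Real.exp (12 * ∫ z, -y z ∂H) := by
  have hi : Integrable (fun z => Real.exp (-a * y z) - 1) H :=
    (h.integrable_exp_mul (-a)).sub (integrable_const _)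
  have hi' : Integrable (fun z => a * (Real.exp (y z) - 1)) H :=
    (h.integrable_exp.sub (integrable_const _)).const_mul a
  have h1 : ∫ z, (Real.exp (-a * y z) - 1 + a * (Real.exp (y z) - 1)) ∂H ≤
      ∫ z, 12 * (1 - Real.exp (y z / 2)) ^ 2 ∂H := by
    refine integral_mono (hi.add hi') (h.integrable_sq.const_mul 12) fun z => ?_
    have := exp_neg_mul_le_sq (t := y z) ((neg_le_abs _).trans (h.abs_le z)) ha ha1 haL
    simpa using this
  rw [integral_add hi hi',
    integral_sub (h.integrable_exp_mul (-a)) (integrable_const _), integral_const_mul a,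
    integral_sub h.integrable_exp (integrable_const _), h.integral_exp,
    integral_const_mul] at h1
  simp only [integral_const, probReal_univ, smul_eq_mul, mul_one, sub_self, mul_zero,
    add_zero] at h1
  have h2 := h.integral_sq_le
  linarith [Real.add_one_le_exp (12 * ∫ z, -y z ∂H)]

theorem lintegral_exp_sum (h : IsLogRatio H L y) (n : ℕ) (a e : ℝ) :
    ∫⁻ D, ENNReal.ofReal (Real.exp (a * ∑ k, y (D k) + e)) ∂(Measure.pi fun _ : Fin n => H) =
      ENNReal.ofReal ((∫ z, Real.exp (a * y z) ∂H) ^ n * Real.exp e) := by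
  have h1 : ∀ D : Fin n → Z, Real.exp (a * ∑ k, y (D k) + e) =
      (∏ k, Real.exp (a * y (D k))) * Real.exp e := fun D => by
    rw [Real.exp_add, Finset.mul_sum, Real.exp_sum]
  simp_rw [h1]
  rw [← ofReal_integral_eq_lintegral_ofReal, integral_mul_const,
    integral_fintype_prod_eq_pow (fun z => Real.exp (a * y z)), Fintype.card_fin]
  · exact (Integrable.fintype_prod fun _ => h.integrable_exp_mul a).mul_const _
  · exact .of_forall fun D => by positivity

theorem lintegral_exp_half_sum_le (h : IsLogRatio H L y) (hc : 5 ≤ c) (hcL : 4 * L ≤ c) (n : ℕ)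
    (e : ℝ) :
    ∫⁻ D, ENNReal.ofReal (Real.exp (1 / 2 * ∑ k, y (D k) + e)) ∂(Measure.pi fun _ : Fin n => H) ≤
      ENNReal.ofReal (Real.exp (e - n * (∫ z, -y z ∂H) / (2 * c))) := by
  rw [h.lintegral_exp_sum]
  apply ENNReal.ofReal_le_ofReal
  have h1 := h.integral_exp_half_le hc hcL
  calc (∫ z, Real.exp (1 / 2 * y z) ∂H) ^ n * Real.exp e
      = (∫ z, Real.exp (y z / 2) ∂H) ^ n * Real.exp e := by
        simp_rw [div_mul_eq_mul_div, one_mul]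
    _ ≤ Real.exp (-(∫ z, -y z ∂H) / (2 * c)) ^ n * Real.exp e := by
        gcongr
    _ = _ := by
        rw [← Real.exp_nat_mul, ← Real.exp_add]; congr 1; ring

theorem lintegral_exp_neg_sum_le (h : IsLogRatio H L y) {a : ℝ} (ha : 0 ≤ a) (ha1 : a ≤ 1)
    (haL : a * L ≤ 1) (n : ℕ) (e : ℝ) :
    ∫⁻ D, ENNReal.ofReal (Real.exp (-a * ∑ k, y (D k) + e)) ∂(Measure.pi fun _ : Fin n => H) ≤
      ENNReal.ofReal (Real.exp (e + 12 * (n * ∫ z, -y z ∂H))) := by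
  rw [h.lintegral_exp_sum]
  apply ENNReal.ofReal_le_ofReal
  calc (∫ z, Real.exp (-a * y z) ∂H) ^ n * Real.exp e
      ≤ Real.exp (12 * ∫ z, -y z ∂H) ^ n * Real.exp e := by
        gcongr
        exact h.integral_exp_neg_mul_le ha ha1 haL
    _ = _ := by
        rw [← Real.exp_nat_mul, ← Real.exp_add]; congr 1; ring

end IsLogRatio

/-! ### Uniform bound for finite classes. -/

/-- A finite class of log-likelihood ratios: with high probability every member whose empirical
log-likelihood ratio is nonnegative has a small relative entropy. -/
theorem exists_event_finite_class {Z J : Type*} [MeasurableSpace Z] {H : Measure Z}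
    [IsProbabilityMeasure H] (s : Finset J) (hs : s.Nonempty) {y : J → Z → ℝ} {L c : ℝ}
    (hy : ∀ j ∈ s, IsLogRatio H L (y j)) (hc : 5 ≤ c) (hcL : 4 * L ≤ c) {n : ℕ} (hn : 1 ≤ n)
    {δ : ℝ} (hδ : 0 < δ) :
    ∃ G : Set (Fin n → Z), MeasurableSet G ∧
      ENNReal.ofReal (1 - δ) ≤ Measure.pi (fun _ : Fin n => H) G ∧
      ∀ D ∈ G, ∀ j ∈ s, 0 ≤ ∑ k, y j (D k) →
        ∫ z, -y j z ∂H ≤ 2 * c * Real.log (s.card / δ) / n := by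
  have hcard : (0 : ℝ) < s.card := by exact_mod_cast hs.card_pos
  have hn0 : (0 : ℝ) < n := by exact_mod_cast hn
  -- Each summand is scaled to have expectation at most `1`, so Markov's inequality costs only the
  -- cardinality.
  set W : (Fin n → Z) → ENNReal := fun D => ∑ j ∈ s, ENNReal.ofReal
    (Real.exp (1 / 2 * ∑ k, y j (D k) + n * (∫ z, -y j z ∂H) / (2 * c))) with hWdef
  have hterm : ∀ j ∈ s, Measurable fun D : Fin n → Z => ENNReal.ofReal
      (Real.exp (1 / 2 * ∑ k, y j (D k) + n * (∫ z, -y j z ∂H) / (2 * c))) := by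
    intro j hj
    have := (hy j hj).measurable
    fun_prop
  have hW : Measurable W := Finset.measurable_fun_sum s hterm
  have hint : ∫⁻ D, W D ∂(Measure.pi fun _ : Fin n => H) ≤ ENNReal.ofReal s.card := by
    rw [hWdef, lintegral_finsetSum' _ fun j hj => (hterm j hj).aemeasurable]
    calc _ ≤ ∑ j ∈ s, (1 : ENNReal) := by
          refine Finset.sum_le_sum fun j hj => ?_
          have := (hy j hj).lintegral_exp_half_sum_le hc hcL n
            (n * (∫ z, -y j z ∂H) / (2 * c))
          simpa using this
      _ = ENNReal.ofReal s.card := by simp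
  refine ⟨_, measurableSet_le hW measurable_const,
    ofReal_one_sub_le_measure_of_lintegral_le hW hcard hδ hint, fun D hD j hj hjD => ?_⟩
  have h1 : ENNReal.ofReal
      (Real.exp (1 / 2 * ∑ k, y j (D k) + n * (∫ z, -y j z ∂H) / (2 * c))) ≤
      ENNReal.ofReal (s.card / δ) :=
    (Finset.single_le_sum (f := fun j => ENNReal.ofReal
      (Real.exp (1 / 2 * ∑ k, y j (D k) + n * (∫ z, -y j z ∂H) / (2 * c))))
      (fun _ _ => zero_le) hj).trans hD
  rw [ENNReal.ofReal_le_ofReal_iff (by positivity)] at h1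
  rw [← Real.le_log_iff_exp_le (by positivity)] at h1
  have h2 : n * (∫ z, -y j z ∂H) / (2 * c) ≤ Real.log (s.card / δ) := by linarith
  rw [div_le_iff₀ (by linarith)] at h2
  rw [le_div_iff₀ hn0]; linarith

/-! ### Uniform bound for concave parametric classes by integration over parameters. -/

/-- Change of variables onto the shrunken copy `v + r Θ` inside `Θ`, whose Jacobian is `r` to the
dimension. -/
theorem setLIntegral_comp_add_smul_le {E : Type*} [NormedAddCommGroup E] [NormedSpace ℝ E]
    [MeasurableSpace E] [BorelSpace E] [FiniteDimensional ℝ E] (μ : Measure E)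
    [μ.IsAddHaarMeasure] {Θ : Set E} (hΘ : MeasurableSet Θ) {r : ℝ} (hr : 0 < r) (v : E)
    (hv : ∀ u ∈ Θ, v + r • u ∈ Θ) {F : E → ENNReal} (hF : Measurable F) :
    ENNReal.ofReal (r ^ Module.finrank ℝ E) * ∫⁻ u in Θ, F (v + r • u) ∂μ ≤
      ∫⁻ θ in Θ, F θ ∂μ := by
  have hG : Measurable (Θ.indicator F) := hF.indicator hΘ
  have h1 : ∫⁻ u in Θ, F (v + r • u) ∂μ ≤ ∫⁻ u, Θ.indicator F (v + r • u) ∂μ := by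
    rw [← lintegral_indicator hΘ]
    refine lintegral_mono fun u => ?_
    by_cases hu : u ∈ Θ
    · simp [hu, hv u hu]
    · simp [hu]
  have h2 : ∫⁻ u, Θ.indicator F (v + r • u) ∂μ =
      ENNReal.ofReal (r ^ Module.finrank ℝ E)⁻¹ * ∫⁻ θ in Θ, F θ ∂μ := by
    have h3 : ∫⁻ u, Θ.indicator F (v + r • u) ∂μ =
        ∫⁻ w, Θ.indicator F (v + w) ∂(Measure.map (fun x => r • x) μ) := by
      rw [lintegral_map (f := fun w => Θ.indicator F (v + w)) (hG.comp (measurable_const_add v))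
        (measurable_const_smul r)]
    rw [h3, Measure.map_addHaar_smul μ hr.ne', lintegral_smul_measure,
      lintegral_add_left_eq_self, lintegral_indicator hΘ, abs_of_pos (by positivity), smul_eq_mul]
  calc _ ≤ ENNReal.ofReal (r ^ Module.finrank ℝ E) *
        (ENNReal.ofReal (r ^ Module.finrank ℝ E)⁻¹ * ∫⁻ θ in Θ, F θ ∂μ) := by
        gcongr; exact h1.trans h2.le
    _ = _ := by
        rw [← mul_assoc, ← ENNReal.ofReal_mul (by positivity), mul_inv_cancel₀ (by positivity),
          ENNReal.ofReal_one, one_mul]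

set_option maxHeartbeats 1000000 in
/-- A finite-dimensional class of log-likelihood ratios that are concave in the parameter: with
high probability every parameter whose empirical log-likelihood ratio is nonnegative has a small
relative entropy `R`. The hypothesis `hext` says that `R` does not decrease by more than a constant
factor, up to `R b`, when `a` is moved slightly in the direction of `b`. -/
theorem exists_event_concave_class {Z E : Type*} [MeasurableSpace Z] {H : Measure Z}
    [IsProbabilityMeasure H] [NormedAddCommGroup E] [NormedSpace ℝ E] [MeasurableSpace E]
    [BorelSpace E] [FiniteDimensional ℝ E] (μ : Measure E) [μ.IsAddHaarMeasure] {Θ : Set E}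
    (hΘ : MeasurableSet Θ) (hconv : Convex ℝ Θ) (hΘ0 : μ Θ ≠ 0) (hΘtop : μ Θ ≠ ⊤)
    {y : E → Z → ℝ} (hmeas : Measurable (Function.uncurry y)) {L c : ℝ}
    (hy : ∀ θ ∈ Θ, IsLogRatio H L (y θ)) (hc : 5 ≤ c) (hcL : 4 * L ≤ c)
    {θs : E} (hθs : θs ∈ Θ) (hzero : ∀ z, y θs z = 0)
    (hconc : ∀ a ∈ Θ, ∀ b ∈ Θ, ∀ t : ℝ, 0 ≤ t → t ≤ 1 → ∀ z,
      (1 - t) * y a z + t * y b z ≤ y ((1 - t) • a + t • b) z)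
    (hext : ∀ a ∈ Θ, ∀ b ∈ Θ, (1 / 2) * (∫ z, -y a z ∂H) - (1 / 2) * (∫ z, -y b z ∂H) ≤
      ∫ z, -y ((1 - 1 / (10 * c)) • a + (1 / (10 * c)) • b) z ∂H)
    (n : ℕ) {δ : ℝ} (hδ : 0 < δ) :
    ∃ G : Set (Fin n → Z), MeasurableSet G ∧
      ENNReal.ofReal (1 - δ) ≤ Measure.pi (fun _ : Fin n => H) G ∧
      ∀ D ∈ G, ∀ θ ∈ Θ, 0 ≤ ∑ k, y θ (D k) →
        n * (∫ z, -y θ z ∂H) ≤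
          8 * c * (2 * Real.log (2 / δ) + Module.finrank ℝ E * Real.log (520 * c ^ 2)) := by
  have hc0 : 0 < c := by linarith
  set R : E → ℝ := fun θ => ∫ z, -y θ z ∂H with hR
  have hRm : Measurable R := by
    have : StronglyMeasurable (Function.uncurry fun θ z => -y θ z) := hmeas.neg.stronglyMeasurable
    exact this.integral_prod_right.measurable
  have hR0 : ∀ θ ∈ Θ, 0 ≤ R θ := fun θ hθ => (hy θ hθ).risk_nonneg
  set α : ℝ := 1 / (10 * c) with hα
  have hα0 : 0 < α := by positivity
  have hα1 : α ≤ 1 := by rw [hα, div_le_one (by positivity)]; linarith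
  -- Chosen so that `13 r = 1/(4c)`: shrinking by `r` turns the exponent of `I 13` into that of `I
  -- (1/(4c))`.
  set r : ℝ := 1 / (52 * c) with hr
  have hr0 : 0 < r := by positivity
  have hr1 : r ≤ 1 := by rw [hr, div_le_one (by positivity)]; linarith
  set I : ℝ → ENNReal := fun m => ∫⁻ θ in Θ, ENNReal.ofReal (Real.exp (-m * (n * R θ))) ∂μ with hI
  have hIm : ∀ m, Measurable fun θ => ENNReal.ofReal (Real.exp (-m * (n * R θ))) := by
    intro m; fun_prop
  have hIpos : ∀ m, I m ≠ 0 := by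
    intro m
    apply ne_of_gt
    rw [hI, setLIntegral_pos_iff (hIm m)]
    have : (Function.support fun θ => ENNReal.ofReal (Real.exp (-m * (n * R θ)))) = Set.univ := by
      ext θ; simp [Real.exp_pos]
    rw [this, Set.univ_inter]
    exact pos_iff_ne_zero.2 hΘ0
  have hItop : ∀ m, 0 ≤ m → I m ≠ ⊤ := by
    intro m hm
    refine ne_top_of_le_ne_top hΘtop ?_
    calc I m ≤ ∫⁻ θ in Θ, 1 ∂μ := by
          refine setLIntegral_mono' hΘ fun θ hθ => ?_
          rw [ENNReal.ofReal_le_one, Real.exp_le_one_iff]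
          have := hR0 θ hθ
          have : 0 ≤ m * (n * R θ) := by positivity
          linarith
      _ = μ Θ := by simp
  have hym : ∀ k : Fin n, Measurable fun q : (Fin n → Z) × E => y q.2 (q.1 k) := fun k =>
    hmeas.comp (measurable_snd.prodMk ((measurable_pi_apply k).comp measurable_fst))
  have hexpm : ∀ p q : ℝ, Measurable fun w : (Fin n → Z) × E =>
      ENNReal.ofReal (Real.exp (p * ∑ k, y w.2 (w.1 k) + q * (n * R w.2))) := by
    intro p q
    have : Measurable fun w : (Fin n → Z) × E => ∑ k, y w.2 (w.1 k) :=
      Finset.measurable_fun_sum _ fun k _ => hym k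
    fun_prop
  set T : ℝ → ℝ → (Fin n → Z) → ENNReal := fun p q D =>
    ∫⁻ θ in Θ, ENNReal.ofReal (Real.exp (p * ∑ k, y θ (D k) + q * (n * R θ))) ∂μ with hT
  have hTm : ∀ p q, Measurable (T p q) := fun p q => (hexpm p q).lintegral_prod_right'
  have hTswap : ∀ p q, ∫⁻ D, T p q D ∂(Measure.pi fun _ : Fin n => H) =
      ∫⁻ θ in Θ, ∫⁻ D, ENNReal.ofReal (Real.exp (p * ∑ k, y θ (D k) + q * (n * R θ)))
        ∂(Measure.pi fun _ : Fin n => H) ∂μ := fun p q =>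
    lintegral_lintegral_swap (hexpm p q).aemeasurable
  -- The reward `1/(4c)` uses half of the decay rate `1/(2c)`; the other half is left over.
  have hA : ∫⁻ D, T (1 / 2) (1 / (4 * c)) D ∂(Measure.pi fun _ : Fin n => H) ≤
      I (1 / (4 * c)) := by
    rw [hTswap]
    refine setLIntegral_mono' hΘ fun θ hθ => ?_
    refine ((hy θ hθ).lintegral_exp_half_sum_le hc hcL n _).trans (le_of_eq ?_)
    congr 2
    change 1 / (4 * c) * (n * R θ) - n * R θ / (2 * c) = _
    field_simp; ring
  -- The moment bound costs `12 n R`, and `1/(8c) - 26 + 12 ≤ -13`. The `26` is twice `13`, as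
  -- required by the inequality between arithmetic and geometric means below.
  have hB : ∫⁻ D, T (-(α / 2)) (1 / (8 * c) - 26) D ∂(Measure.pi fun _ : Fin n => H) ≤ I 13 := by
    rw [hTswap]
    refine setLIntegral_mono' hΘ fun θ hθ => ?_
    have haL : α / 2 * L ≤ 1 := by
      rw [hα, div_div, div_mul_eq_mul_div, one_mul, div_le_one (by positivity)]; linarith
    refine ((hy θ hθ).lintegral_exp_neg_sum_le (by positivity) (by linarith) haL n _).trans
      (ENNReal.ofReal_le_ofReal (Real.exp_le_exp.2 ?_))
    change (1 / (8 * c) - 26) * (n * R θ) + 12 * (n * R θ) ≤ -13 * (n * R θ)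
    have h1 : 1 / (8 * c) ≤ 1 := by rw [div_le_one (by positivity)]; linarith
    have h2 : 0 ≤ n * R θ := mul_nonneg (Nat.cast_nonneg _) (hR0 θ hθ)
    nlinarith
  set W : (Fin n → Z) → ENNReal := fun D =>
    T (1 / 2) (1 / (4 * c)) D / I (1 / (4 * c)) + T (-(α / 2)) (1 / (8 * c) - 26) D / I 13 with hW
  have hWm : Measurable W := ((hTm _ _).div_const _).add ((hTm _ _).div_const _)
  have hWint : ∫⁻ D, W D ∂(Measure.pi fun _ : Fin n => H) ≤ ENNReal.ofReal 2 := by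
    have hdiv : ∀ (f : (Fin n → Z) → ENNReal) (K : ENNReal), Measurable f →
        ∫⁻ D, f D ∂(Measure.pi fun _ : Fin n => H) ≤ K →
        ∫⁻ D, f D / K ∂(Measure.pi fun _ : Fin n => H) ≤ 1 := by
      intro f K hf h
      simp_rw [div_eq_mul_inv]
      rw [lintegral_mul_const _ hf, ← div_eq_mul_inv]
      exact ENNReal.div_le_of_le_mul (by rwa [one_mul])
    rw [hW, lintegral_add_left ((hTm _ _).div_const _)]
    calc _ ≤ (1 : ENNReal) + 1 :=
          add_le_add (hdiv _ _ (hTm _ _) hA) (hdiv _ _ (hTm _ _) hB)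
      _ = ENNReal.ofReal 2 := by norm_num
  refine ⟨_, measurableSet_le hWm measurable_const,
    ofReal_one_sub_le_measure_of_lintegral_le hWm two_pos hδ hWint, fun D hD θ hθ hD0 => ?_⟩
  set t : ℝ := 2 / δ with ht
  have ht0 : 0 < t := by positivity
  have hDA : T (1 / 2) (1 / (4 * c)) D ≤ ENNReal.ofReal t * I (1 / (4 * c)) := by
    rw [← ENNReal.div_le_iff (hIpos _) (hItop _ (by positivity))]
    exact le_self_add.trans hD
  have hDB : T (-(α / 2)) (1 / (8 * c) - 26) D ≤ ENNReal.ofReal t * I 13 := by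
    rw [← ENNReal.div_le_iff (hIpos _) (hItop _ (by norm_num))]
    exact le_add_self.trans hD
  have hDm : ∀ p q : ℝ, Measurable fun θ =>
      ENNReal.ofReal (Real.exp (p * ∑ k, y θ (D k) + q * (n * R θ))) := fun p q =>
    (hexpm p q).comp measurable_prodMk_left
  set J : ENNReal := T (α / 2) (-(1 / (8 * c))) D with hJ
  -- Lower bound on `J`: pointwise `2 exp V ≤ t exp P + t⁻¹ exp (2V - P)`. The integral of the last
  -- term is at most `I 13` on the event, and is cancelled against one of the two copies of `I 13`.
  have hIJ : I 13 ≤ ENNReal.ofReal t * J := by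
    have h1 : I 13 + I 13 ≤ ENNReal.ofReal t * J +
        ENNReal.ofReal t⁻¹ * T (-(α / 2)) (1 / (8 * c) - 26) D := by
      rw [hI, hJ, hT]
      dsimp only
      rw [← lintegral_add_left (hIm 13), ← lintegral_const_mul _ (hDm _ _),
        ← lintegral_const_mul _ (hDm _ _), ← lintegral_add_left ((hDm _ _).const_mul _)]
      refine lintegral_mono fun u => ?_
      rw [← ENNReal.ofReal_mul ht0.le, ← ENNReal.ofReal_mul (by positivity),
        ← ENNReal.ofReal_add (by positivity) (by positivity),
        ← ENNReal.ofReal_add (by positivity) (by positivity)]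
      apply ENNReal.ofReal_le_ofReal
      set P := α / 2 * ∑ k, y u (D k) + -(1 / (8 * c)) * (n * R u) with hP
      have e1 : -(α / 2) * ∑ k, y u (D k) + (1 / (8 * c) - 26) * (n * R u) =
          2 * (-13 * (n * R u)) - P := by rw [hP]; ring
      rw [e1]
      set V := -13 * (n * R u)
      have e2 : Real.exp (2 * V - P) = Real.exp V ^ 2 * (Real.exp P)⁻¹ := by
        rw [Real.exp_sub, ← Real.exp_nat_mul, div_eq_mul_inv]; norm_num
      rw [e2]
      have hp := Real.exp_pos P
      have e3 : t⁻¹ * (Real.exp V ^ 2 * (Real.exp P)⁻¹) =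
          Real.exp V ^ 2 / (t * Real.exp P) := by field_simp
      rw [e3, ← sub_le_iff_le_add', le_div_iff₀ (by positivity)]
      nlinarith [sq_nonneg (Real.exp V - t * Real.exp P)]
    have h2 : ENNReal.ofReal t⁻¹ * T (-(α / 2)) (1 / (8 * c) - 26) D ≤ I 13 := by
      calc _ ≤ ENNReal.ofReal t⁻¹ * (ENNReal.ofReal t * I 13) := by gcongr
        _ = I 13 := by
            rw [← mul_assoc, ← ENNReal.ofReal_mul (by positivity), inv_mul_cancel₀ ht0.ne',
              ENNReal.ofReal_one, one_mul]
    exact (ENNReal.add_le_add_iff_right (hItop 13 (by norm_num))).1 (h1.trans (by gcongr))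
  have hcomb : ∀ a ∈ Θ, ∀ s : ℝ, 0 ≤ s → s ≤ 1 → ∀ u ∈ Θ, (1 - s) • a + s • u ∈ Θ :=
    fun a ha s hs hs1 u hu => hconv ha hu (sub_nonneg.2 hs1) hs (by ring)
  -- Shrinking towards the true parameter, where the risk vanishes, multiplies the risk by at most
  -- `r` because it is convex.
  have hII : ENNReal.ofReal (r ^ Module.finrank ℝ E) * I (1 / (4 * c)) ≤ I 13 := by
    refine le_trans ?_ (setLIntegral_comp_add_smul_le μ hΘ hr0 ((1 - r) • θs)
      (fun u hu => hcomb θs hθs r hr0.le hr1 u hu) (hIm 13))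
    gcongr
    refine setLIntegral_mono' hΘ fun u hu => ENNReal.ofReal_le_ofReal (Real.exp_le_exp.2 ?_)
    have h1 : R ((1 - r) • θs + r • u) ≤ r * R u := by
      rw [hR]
      dsimp only
      rw [← integral_const_mul]
      refine integral_mono (hy _ (hcomb θs hθs r hr0.le hr1 u hu)).integrable.neg
        ((hy u hu).integrable.neg.const_mul r) fun z => ?_
      have := hconc θs hθs u hu r hr0.le hr1 z
      rw [hzero] at this
      linarith
    have h2 : 13 * (n * R ((1 - r) • θs + r • u)) ≤ 13 * (n * (r * R u)) := by gcongr
    have h3 : 13 * (n * (r * R u)) = 1 / (4 * c) * (n * R u) := by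
      rw [hr]; field_simp; ring
    linarith
  -- Shrinking towards `θ`: concavity and the nonnegative empirical ratio at `θ` leave `α ∑ y_u`,
  -- and `hext` extracts the factor `exp (n R θ / (8c))`.
  have hAJ : ENNReal.ofReal (α ^ Module.finrank ℝ E) *
      (ENNReal.ofReal (Real.exp (n * R θ / (8 * c))) * J) ≤ T (1 / 2) (1 / (4 * c)) D := by
    refine le_trans ?_ (setLIntegral_comp_add_smul_le μ hΘ hα0 ((1 - α) • θ)
      (fun u hu => hcomb θ hθ α hα0.le hα1 u hu) (hDm _ _))
    gcongr
    rw [hJ, hT]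
    dsimp only
    rw [← lintegral_const_mul _ (hDm _ _)]
    refine setLIntegral_mono' hΘ fun u hu => ?_
    rw [← ENNReal.ofReal_mul (Real.exp_pos _).le, ← Real.exp_add]
    refine ENNReal.ofReal_le_ofReal (Real.exp_le_exp.2 ?_)
    have h1 : α * ∑ k, y u (D k) ≤ ∑ k, y ((1 - α) • θ + α • u) (D k) := by
      have : ∑ k, ((1 - α) * y θ (D k) + α * y u (D k)) ≤
          ∑ k, y ((1 - α) • θ + α • u) (D k) :=
        Finset.sum_le_sum fun k _ => hconc θ hθ u hu α hα0.le hα1 (D k)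
      rw [Finset.sum_add_distrib, ← Finset.mul_sum, ← Finset.mul_sum] at this
      have h := mul_nonneg (sub_nonneg.2 hα1) hD0
      linarith
    have h2 : (1 / 2) * R θ - (1 / 2) * R u ≤ R ((1 - α) • θ + α • u) := hext θ hθ u hu
    have h3 : 1 / (4 * c) * (n * ((1 / 2) * R θ - (1 / 2) * R u)) ≤
        1 / (4 * c) * (n * R ((1 - α) • θ + α • u)) := by gcongr
    have h4 : 1 / (4 * c) * (n * ((1 / 2) * R θ - (1 / 2) * R u)) =
        n * R θ / (8 * c) + -(1 / (8 * c)) * (n * R u) := by field_simp; ring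
    linarith
  -- The chain returns to `I (1/(4c))`, which is positive and finite and cancels.
  have hfinal : ENNReal.ofReal (α ^ Module.finrank ℝ E * Real.exp (n * R θ / (8 * c)) *
      r ^ Module.finrank ℝ E) ≤ ENNReal.ofReal (t ^ 2) := by
    rw [← ENNReal.mul_le_mul_iff_left (hIpos (1 / (4 * c))) (hItop (1 / (4 * c)) (by positivity)),
      ENNReal.ofReal_mul (by positivity), ENNReal.ofReal_mul (by positivity), mul_assoc]
    calc _ ≤ ENNReal.ofReal (α ^ Module.finrank ℝ E) *
          ENNReal.ofReal (Real.exp (n * R θ / (8 * c))) * (ENNReal.ofReal t * J) :=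
          mul_le_mul' le_rfl (hII.trans hIJ)
      _ = ENNReal.ofReal t * (ENNReal.ofReal (α ^ Module.finrank ℝ E) *
          (ENNReal.ofReal (Real.exp (n * R θ / (8 * c))) * J)) := by ring
      _ ≤ ENNReal.ofReal t * (ENNReal.ofReal t * I (1 / (4 * c))) :=
          mul_le_mul' le_rfl (hAJ.trans hDA)
      _ = _ := by rw [← mul_assoc, ← ENNReal.ofReal_mul ht0.le, sq]
  rw [ENNReal.ofReal_le_ofReal_iff (by positivity)] at hfinal
  have hlog := Real.log_le_log (by positivity) hfinal
  rw [Real.log_mul (by positivity) (by positivity), Real.log_mul (by positivity) (by positivity),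
    Real.log_exp, Real.log_pow, Real.log_pow, Real.log_pow] at hlog
  have hαr : Real.log α + Real.log r = -Real.log (520 * c ^ 2) := by
    rw [← Real.log_mul hα0.ne' hr0.ne', ← Real.log_inv, hα, hr]
    congr 1; field_simp; norm_num
  have h5 : n * R θ / (8 * c) ≤
      2 * Real.log t + Module.finrank ℝ E * Real.log (520 * c ^ 2) := by
    push_cast at hlog
    linear_combination hlog - (Module.finrank ℝ E : ℝ) * hαr
  rw [div_le_iff₀ (by positivity)] at h5
  linarith

/-! ### Multinomial logit probabilities and their geometric mixtures. -/

section Probabilities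

variable {N : ℕ} (S : Finset (Fin N)) {u v w : Fin N → ℝ}

/-- The outcomes that have positive probability when the assortment `S` is offered. -/
def outcomes : Finset (Fin (N + 1)) :=
  insert 0 (S.map (Fin.succEmb N))

theorem succ_mem_outcomes {j : Fin N} : j.succ ∈ outcomes S ↔ j ∈ S := by
  simp [outcomes, Fin.succ_ne_zero]

theorem zero_mem_outcomes : 0 ∈ outcomes S := by
  simp [outcomes]

theorem one_add_sum_pos (hv : ∀ j, 0 < v j) : 0 < 1 + ∑ j ∈ S, v j := by
  have := Finset.sum_nonneg fun j (_ : j ∈ S) => (hv j).le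
  linarith

theorem mnlProb_zero : mnlProb S v 0 = 1 / (1 + ∑ j ∈ S, v j) := rfl

theorem mnlProb_succ (j : Fin N) :
    mnlProb S v j.succ = (if j ∈ S then v j else 0) / (1 + ∑ j ∈ S, v j) := rfl

theorem mnlProb_eq_zero {i : Fin (N + 1)} (hi : i ∉ outcomes S) : mnlProb S v i = 0 := by
  induction i using Fin.cases with
  | zero => exact absurd (zero_mem_outcomes S) hi
  | succ j => rw [succ_mem_outcomes] at hi; simp [mnlProb_succ, hi]

theorem mnlProb_pos (hv : ∀ j, 0 < v j) {i : Fin (N + 1)} (hi : i ∈ outcomes S) :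
    0 < mnlProb S v i := by
  have := one_add_sum_pos S hv
  induction i using Fin.cases with
  | zero => rw [mnlProb_zero]; positivity
  | succ j =>
    rw [succ_mem_outcomes] at hi
    rw [mnlProb_succ, if_pos hi]
    exact div_pos (hv j) this

theorem mnlProb_nonneg (hv : ∀ j, 0 < v j) (i : Fin (N + 1)) : 0 ≤ mnlProb S v i := by
  by_cases hi : i ∈ outcomes S
  · exact (mnlProb_pos S hv hi).le
  · exact (mnlProb_eq_zero S hi).ge

theorem sum_mnlProb (hv : ∀ j, 0 < v j) : ∑ i, mnlProb S v i = 1 := by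
  have := one_add_sum_pos S hv
  rw [Fin.sum_univ_succ, mnlProb_zero]
  simp_rw [mnlProb_succ]
  rw [← Finset.sum_div, ← add_div, div_eq_one_iff_eq this.ne']
  simp

theorem sum_mnlProb_mul (φ : Fin (N + 1) → ℝ) :
    ∑ i, mnlProb S v i * φ i = ∑ i ∈ outcomes S, mnlProb S v i * φ i := by
  refine (Finset.sum_subset (Finset.subset_univ _) fun i _ hi => ?_).symm
  rw [mnlProb_eq_zero S hi, zero_mul]

theorem sum_exp_log_mnlProb (hv : ∀ j, 0 < v j) :
    ∑ i ∈ outcomes S, Real.exp (Real.log (mnlProb S v i)) = 1 := by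
  rw [← sum_mnlProb S hv]
  have := sum_mnlProb_mul S (v := v) fun _ => 1
  simp only [mul_one] at this
  rw [this]
  exact Finset.sum_congr rfl fun i hi => Real.exp_log (mnlProb_pos S hv hi)

theorem mnlProb_le_one (hv : ∀ j, 0 < v j) (i : Fin (N + 1)) : mnlProb S v i ≤ 1 := by
  rw [← sum_mnlProb S hv]
  exact Finset.single_le_sum (fun i _ => mnlProb_nonneg S hv i) (Finset.mem_univ i)

theorem log_mnlProb (hv : ∀ j, 0 < v j) {i : Fin (N + 1)} (hi : i ∈ outcomes S) :
    Real.log (mnlProb S v i) =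
      Fin.cases (motive := fun _ => ℝ) 0 (fun j => Real.log (v j)) i
        - Real.log (1 + ∑ j ∈ S, v j) := by
  have hS := one_add_sum_pos S hv
  induction i using Fin.cases with
  | zero => rw [mnlProb_zero, Real.log_div one_ne_zero hS.ne', Real.log_one]; rfl
  | succ j =>
    rw [succ_mem_outcomes] at hi
    rw [mnlProb_succ, if_pos hi, Real.log_div (hv j).ne' hS.ne']; rfl

/-- Numerator and normalizer each contribute at most `log (1/β)`, whatever the size of `S`.
Impossible outcomes contribute `0` because `Real.log 0 = 0`. -/
theorem log_mnlProb_sub_le {β : ℝ} (hβ : 0 < β) (hβ1 : β ≤ 1) (hv : ∀ j, v j ∈ Set.Icc β 1)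
    (hw : ∀ j, w j ∈ Set.Icc β 1) (i : Fin (N + 1)) :
    Real.log (mnlProb S v i) - Real.log (mnlProb S w i) ≤ 2 * Real.log (1 / β) := by
  have hv0 : ∀ j, 0 < v j := fun j => hβ.trans_le (hv j).1
  have hw0 : ∀ j, 0 < w j := fun j => hβ.trans_le (hw j).1
  have hvS := one_add_sum_pos S hv0
  have hwS := one_add_sum_pos S hw0
  have hlog : 0 ≤ Real.log (1 / β) := Real.log_nonneg (by rwa [le_div_iff₀ hβ, one_mul])
  by_cases hi : i ∈ outcomes S
  swap
  · rw [mnlProb_eq_zero S hi, mnlProb_eq_zero S hi, sub_self]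
    linarith
  have hden : 1 + ∑ j ∈ S, w j ≤ 1 / β * (1 + ∑ j ∈ S, v j) := by
    have h1 : ∑ j ∈ S, w j ≤ ∑ j ∈ S, 1 / β * v j := by
      refine Finset.sum_le_sum fun j _ => ?_
      rw [div_mul_eq_mul_div, one_mul, le_div_iff₀ hβ]
      nlinarith [(hw j).2, (hv j).1]
    have h2 : 1 ≤ 1 / β := by rwa [le_div_iff₀ hβ, one_mul]
    rw [mul_add, Finset.mul_sum]; linarith
  have hden' := Real.log_le_log hwS hden
  rw [Real.log_mul (by positivity) hvS.ne'] at hden'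
  have hnum : Fin.cases (motive := fun _ => ℝ) 0 (fun j => Real.log (v j)) i -
      Fin.cases (motive := fun _ => ℝ) 0 (fun j => Real.log (w j)) i ≤ Real.log (1 / β) := by
    induction i using Fin.cases with
    | zero => simpa using hlog
    | succ j =>
      have h1 : Real.log (v j) ≤ 0 := Real.log_nonpos (hv0 j).le (hv j).2
      have h2 : Real.log β ≤ Real.log (w j) := Real.log_le_log hβ (hw j).1
      rw [one_div, Real.log_inv]
      simp only [Fin.cases_succ]
      linarith
  rw [log_mnlProb S hv0 hi, log_mnlProb S hw0 hi]
  linarith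

/-- Geometric mixtures of value functions give normalized geometric mixtures of the
multinomial logit distributions. -/
theorem exists_log_mnlProb_geometricMixture (hu : ∀ j, 0 < u j) (hv : ∀ j, 0 < v j)
    (hw : ∀ j, 0 < w j) {t : ℝ}
    (h : ∀ j, Real.log (w j) = (1 - t) * Real.log (u j) + t * Real.log (v j)) :
    ∃ κ, ∀ i ∈ outcomes S, Real.log (mnlProb S w i) =
      (1 - t) * Real.log (mnlProb S u i) + t * Real.log (mnlProb S v i) + κ := by
  refine ⟨(1 - t) * Real.log (1 + ∑ j ∈ S, u j) + t * Real.log (1 + ∑ j ∈ S, v j) -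
    Real.log (1 + ∑ j ∈ S, w j), fun i hi => ?_⟩
  rw [log_mnlProb S hu hi, log_mnlProb S hv hi, log_mnlProb S hw hi]
  induction i using Fin.cases with
  | zero => simp only [Fin.cases_zero]; ring
  | succ j => simp only [Fin.cases_succ, h]; ring

theorem log_mnlProb_geometricMixture_ge (hu : ∀ j, 0 < u j) (hv : ∀ j, 0 < v j)
    (hw : ∀ j, 0 < w j) {t : ℝ} (ht : 0 ≤ t) (ht1 : t ≤ 1)
    (h : ∀ j, Real.log (w j) = (1 - t) * Real.log (u j) + t * Real.log (v j))
    (i : Fin (N + 1)) :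
    (1 - t) * Real.log (mnlProb S u i) + t * Real.log (mnlProb S v i) ≤
      Real.log (mnlProb S w i) := by
  by_cases hi : i ∈ outcomes S
  · obtain ⟨κ, hκ⟩ := exists_log_mnlProb_geometricMixture S hu hv hw h
    have h1 := sum_exp_log_mnlProb S hw
    rw [Finset.sum_congr rfl fun i hi => by rw [hκ i hi]] at h1
    have := geometricMixture_logNormalizer_nonneg _ (sum_exp_log_mnlProb S hu)
      (sum_exp_log_mnlProb S hv) ht ht1 h1
    rw [hκ i hi]; linarith
  · simp [mnlProb_eq_zero S hi]

/-- Moving the value function `u` slightly in the direction of `v` decreases the relative entropy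
by at most a constant factor, up to the relative entropy of `v`. -/
theorem sum_mnlProb_mul_geometricMixture_ge {p : Fin N → ℝ} (hp : ∀ j, 0 < p j)
    {β c : ℝ} (hβ : 0 < β) (hβ1 : β ≤ 1) (hu : ∀ j, u j ∈ Set.Icc β 1)
    (hv : ∀ j, v j ∈ Set.Icc β 1) (hw : ∀ j, 0 < w j) (hc : 5 ≤ c)
    (hcL : 4 * (2 * Real.log (1 / β)) ≤ c)
    (h : ∀ j, Real.log (w j) =
      (1 - 1 / (10 * c)) * Real.log (u j) + 1 / (10 * c) * Real.log (v j)) :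
    ∑ i, mnlProb S p i *
      ((1 / 2) * (Real.log (mnlProb S p i) - Real.log (mnlProb S u i)) -
        (1 / 2) * (Real.log (mnlProb S p i) - Real.log (mnlProb S v i))) ≤
    ∑ i, mnlProb S p i * (Real.log (mnlProb S p i) - Real.log (mnlProb S w i)) := by
  have hu0 : ∀ j, 0 < u j := fun j => hβ.trans_le (hu j).1
  have hv0 : ∀ j, 0 < v j := fun j => hβ.trans_le (hv j).1
  obtain ⟨κ, hκ⟩ := exists_log_mnlProb_geometricMixture S hu0 hv0 hw h
  rw [sum_mnlProb_mul, sum_mnlProb_mul]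
  have hm := sum_exp_log_mnlProb S hw
  rw [Finset.sum_congr rfl fun i hi => by rw [hκ i hi]] at hm
  have hP := sum_exp_log_mnlProb S hp
  have hU := sum_exp_log_mnlProb S hu0
  have hV := sum_exp_log_mnlProb S hv0
  have key := geometricMixture_logNormalizer_le (outcomes S) hP hU hV
    (fun i _ => log_mnlProb_sub_le S hβ hβ1 hu hv i) hc hcL rfl hm
  have hDU := (Finset.sum_nonneg fun i _ => sq_nonneg _).trans
    (sum_sq_exp_half_sub_le (outcomes S) hP hU)
  have hDV := (Finset.sum_nonneg fun i _ => sq_nonneg _).trans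
    (sum_sq_exp_half_sub_le (outcomes S) hP hV)
  have hexp : ∀ i ∈ outcomes S, Real.exp (Real.log (mnlProb S p i)) = mnlProb S p i :=
    fun i hi => Real.exp_log (mnlProb_pos S hp hi)
  have hDUeq : ∀ x : Fin N → ℝ, ∑ i ∈ outcomes S, Real.exp (Real.log (mnlProb S p i)) *
      (Real.log (mnlProb S p i) - Real.log (mnlProb S x i)) = ∑ i ∈ outcomes S, mnlProb S p i *
      (Real.log (mnlProb S p i) - Real.log (mnlProb S x i)) := fun x =>
    Finset.sum_congr rfl fun i hi => by rw [hexp i hi]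
  rw [hDUeq] at hDU hDV
  rw [hDUeq, hDUeq] at key
  have hp1 : ∑ i ∈ outcomes S, mnlProb S p i = 1 := by
    rw [← hP]; exact Finset.sum_congr rfl fun i hi => (hexp i hi).symm
  set t := 1 / (10 * c)
  have ht : t ≤ 1 / 50 := by
    rw [div_le_div_iff₀ (by linarith) (by norm_num)]; linarith
  have ht0 : 0 ≤ t := by positivity
  set DU := ∑ i ∈ outcomes S, mnlProb S p i *
      (Real.log (mnlProb S p i) - Real.log (mnlProb S u i)) with hDUdef
  set DV := ∑ i ∈ outcomes S, mnlProb S p i *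
      (Real.log (mnlProb S p i) - Real.log (mnlProb S v i)) with hDVdef
  have e1 : ∑ i ∈ outcomes S, mnlProb S p i *
      ((1 / 2) * (Real.log (mnlProb S p i) - Real.log (mnlProb S u i)) -
        (1 / 2) * (Real.log (mnlProb S p i) - Real.log (mnlProb S v i))) =
      (1 / 2) * DU - (1 / 2) * DV := by
    rw [hDUdef, hDVdef, Finset.mul_sum, Finset.mul_sum, ← Finset.sum_sub_distrib]
    exact Finset.sum_congr rfl fun i _ => by ring
  have e2 : ∑ i ∈ outcomes S, mnlProb S p i *
      (Real.log (mnlProb S p i) - Real.log (mnlProb S w i)) =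
      (1 - t) * DU + t * DV - κ := by
    calc _ = ∑ i ∈ outcomes S, ((1 - t) * (mnlProb S p i *
          (Real.log (mnlProb S p i) - Real.log (mnlProb S u i))) + t * (mnlProb S p i *
          (Real.log (mnlProb S p i) - Real.log (mnlProb S v i))) - mnlProb S p i * κ) :=
          Finset.sum_congr rfl fun i hi => by rw [hκ i hi]; ring
      _ = _ := by
          rw [Finset.sum_sub_distrib, Finset.sum_add_distrib, ← Finset.mul_sum, ← Finset.mul_sum,
            ← Finset.sum_mul, hp1, one_mul]
  rw [e1, e2]
  -- The mixture has relative entropy `(1 - t) DU + t DV - κ`, where `κ ≤ 2/5 (DU + DV)` and `t ≤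
  -- 1/50`; since `1 - 1/50 - 2/5 ≥ 1/2`, the constants close.
  nlinarith

end Probabilities

/-! ### Measurability and disintegration over the purchase decision. -/

instance (N K : ℕ) : Finite (Assortment N K) :=
  inferInstanceAs (Finite {S : Finset (Fin N) // 1 ≤ S.card ∧ S.card ≤ K})

instance (N K : ℕ) : DiscreteMeasurableSpace (Assortment N K) := ⟨fun _ => trivial⟩

theorem measurable_mnlProb {N K : ℕ} :
    Measurable fun q : ((Fin N → ℝ) × Assortment N K) × Fin (N + 1) =>
      mnlProb q.1.2.1 q.1.1 q.2 := by
  refine measurable_from_prod_countable_left fun i =>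
    measurable_from_prod_countable_left fun S => ?_
  have hden : Measurable fun v : Fin N → ℝ => 1 + ∑ j ∈ S.1, v j :=
    (Finset.measurable_fun_sum _ fun j _ => measurable_pi_apply j).const_add 1
  induction i using Fin.cases with
  | zero => exact measurable_const.div hden
  | succ j =>
    by_cases hj : j ∈ S.1
    · simp only [mnlProb_succ, if_pos hj]
      exact (measurable_pi_apply j).div hden
    · simp only [mnlProb_succ, if_neg hj]
      exact measurable_const.div hden

section Disintegration

variable {Y J : Type*} [MeasurableSpace Y] [Fintype J] [MeasurableSpace J]
  [MeasurableSingletonClass J] {H : Measure (Y × J)} {w : J → Y → ENNReal}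

/-- The second coordinate takes finitely many values, so slicing a measurable set along it reduces
the measure to the rectangles in the hypothesis. -/
theorem eq_sum_map_withDensity
    (hH : ∀ i A, MeasurableSet A → H (A ×ˢ {i}) = ∫⁻ p in A, w i p ∂H.fst) :
    H = ∑ i, Measure.map (fun p => (p, i)) (H.fst.withDensity (w i)) := by
  ext s hs
  have hsl : ∀ i : J, MeasurableSet ((fun p : Y => (p, i)) ⁻¹' s) := fun i =>
    measurable_prodMk_right hs
  have hunion : s = ⋃ i ∈ (Finset.univ : Finset J), ((fun p : Y => (p, i)) ⁻¹' s) ×ˢ {i} := by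
    ext ⟨p, j⟩
    simp
  conv_lhs => rw [hunion]
  rw [measure_biUnion_finset, Measure.finsetSum_apply]
  · refine Finset.sum_congr rfl fun i _ => ?_
    rw [hH i _ (hsl i), Measure.map_apply measurable_prodMk_right hs, withDensity_apply _ (hsl i)]
  · intro i _ j _ hij
    refine Set.disjoint_left.2 fun z hz hz' => hij ?_
    rw [← (Set.mem_prod.1 hz).2, ← (Set.mem_prod.1 hz').2]
  · exact fun i _ => (hsl i).prod (measurableSet_singleton i)

end Disintegration

/-! ### Log-loss differences under a distribution that follows the model. -/

theorem abs_logLoss_sub_le {X : Type*} {N K : ℕ} {fstar f : X → Fin N → ℝ} {β : ℝ}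
    (hβ : 0 < β) (hβ1 : β ≤ 1) (hf : ∀ x j, f x j ∈ Set.Icc β 1)
    (hfs : ∀ x j, fstar x j ∈ Set.Icc β 1)
    (z : Sample X N K) : |logLoss fstar z - logLoss f z| ≤ 2 * Real.log (1 / β) := by
  have h1 := log_mnlProb_sub_le z.1.2.1 hβ hβ1 (hf z.1.1) (hfs z.1.1) z.2
  have h2 := log_mnlProb_sub_le z.1.2.1 hβ hβ1 (hfs z.1.1) (hf z.1.1) z.2
  unfold logLoss
  rw [abs_le]
  constructor <;> linarith

section Model

variable {X : Type*} [MeasurableSpace X] {N K : ℕ} {H : Measure (Sample X N K)}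
  [IsProbabilityMeasure H] {fstar f : X → Fin N → ℝ}

theorem measurable_mnlProb_sample (hf : Measurable f) :
    Measurable fun z : Sample X N K => mnlProb z.1.2.1 (f z.1.1) z.2 := by
  have h1 : Measurable fun z : Sample X N K => f z.1.1 :=
    hf.comp (measurable_fst.comp measurable_fst)
  have h2 : Measurable fun z : Sample X N K => ((f z.1.1, z.1.2), z.2) :=
    (h1.prodMk (measurable_snd.comp measurable_fst)).prodMk measurable_snd
  have h3 := measurable_mnlProb.comp h2
  rw [Function.comp_def] at h3
  exact h3

theorem measurable_logLoss (hf : Measurable f) :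
    Measurable (logLoss f : Sample X N K → ℝ) :=
  (measurable_mnlProb_sample hf).log.neg

theorem integral_eq_integral_sum_mnlProb (hfs : Measurable fstar) (hpos : ∀ x j, 0 < fstar x j)
    (hH : FollowsMNL H fstar) {φ : Sample X N K → ℝ} (hφ : Measurable φ) {C : ℝ}
    (hC : ∀ z, |φ z| ≤ C) :
    ∫ z, φ z ∂H = ∫ p, ∑ i, mnlProb p.2.1 (fstar p.1) i * φ (p, i) ∂H.fst := by
  have hwm : ∀ i, Measurable fun p : X × Assortment N K => mnlProb p.2.1 (fstar p.1) i := fun i =>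
    (measurable_mnlProb_sample hfs).comp (measurable_prodMk_right (y := i))
  have hφi : ∀ i, Measurable fun p : X × Assortment N K => φ (p, i) := fun i =>
    hφ.comp measurable_prodMk_right
  have hEq := eq_sum_map_withDensity hH
  have hint : Integrable φ H := .of_bound hφ.aestronglyMeasurable C (.of_forall hC)
  have hint' := hint
  rw [hEq, integrable_finsetSum_measure] at hint'
  conv_lhs => rw [hEq]
  rw [integral_finsetSum_measure hint', integral_finsetSum]
  · refine Finset.sum_congr rfl fun i _ => ?_
    rw [integral_map measurable_prodMk_right.aemeasurable hφ.aestronglyMeasurable,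
      integral_withDensity_eq_integral_toReal_smul (hwm i).ennreal_ofReal
        (.of_forall fun _ => ENNReal.ofReal_lt_top)]
    refine integral_congr_ae (.of_forall fun p => ?_)
    simp only [smul_eq_mul]
    rw [ENNReal.toReal_ofReal (mnlProb_nonneg _ (hpos p.1) i)]
  · intro i _
    refine Integrable.of_bound (C := 1 * C) ((hwm i).mul (hφi i)).aestronglyMeasurable
      (.of_forall fun p => ?_)
    rw [norm_mul, Real.norm_eq_abs, Real.norm_eq_abs,
      abs_of_nonneg (mnlProb_nonneg _ (hpos p.1) i)]
    exact mul_le_mul (mnlProb_le_one _ (hpos p.1) i) (hC _) (abs_nonneg _) zero_le_one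

theorem integral_le_of_sum_mnlProb_le (hfs : Measurable fstar) (hpos : ∀ x j, 0 < fstar x j)
    (hH : FollowsMNL H fstar) {φ ψ : Sample X N K → ℝ} (hφ : Measurable φ) (hψ : Measurable ψ)
    {C C' : ℝ} (hC : ∀ z, |φ z| ≤ C) (hC' : ∀ z, |ψ z| ≤ C')
    (h : ∀ p : X × Assortment N K, ∑ i, mnlProb p.2.1 (fstar p.1) i * φ (p, i) ≤
      ∑ i, mnlProb p.2.1 (fstar p.1) i * ψ (p, i)) :
    ∫ z, φ z ∂H ≤ ∫ z, ψ z ∂H := by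
  have hi : Integrable φ H := .of_bound hφ.aestronglyMeasurable C (.of_forall hC)
  have hi' : Integrable ψ H := .of_bound hψ.aestronglyMeasurable C' (.of_forall hC')
  have h1 : ∫ z, (ψ z - φ z) ∂H =
      ∫ p, ∑ i, mnlProb p.2.1 (fstar p.1) i * (ψ (p, i) - φ (p, i)) ∂H.fst :=
    integral_eq_integral_sum_mnlProb hfs hpos hH (hψ.sub hφ) (C := C' + C)
      fun z => (abs_sub _ _).trans (add_le_add (hC' z) (hC z))
  rw [integral_sub hi' hi] at h1
  have h2 : 0 ≤ ∫ p, ∑ i, mnlProb p.2.1 (fstar p.1) i * (ψ (p, i) - φ (p, i)) ∂H.fst := by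
    refine integral_nonneg fun p => ?_
    simp only [mul_sub, Finset.sum_sub_distrib]
    exact sub_nonneg.2 (h p)
  linarith

/-- Given `(x, S)`, all models with positive values have the same support, so weighting the
likelihood ratio by the true probabilities leaves the other distribution, of total mass `1`. -/
theorem isLogRatio_logLoss_sub (hfsm : Measurable fstar) (hfm : Measurable f) {β : ℝ}
    (hβ : 0 < β) (hβ1 : β ≤ 1) (hf : ∀ x j, f x j ∈ Set.Icc β 1)
    (hfs : ∀ x j, fstar x j ∈ Set.Icc β 1) (hH : FollowsMNL H fstar) :
    IsLogRatio H (2 * Real.log (1 / β)) fun z => logLoss fstar z - logLoss f z where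
  measurable := (measurable_logLoss hfsm).sub (measurable_logLoss hfm)
  abs_le := abs_logLoss_sub_le hβ hβ1 hf hfs
  integral_exp := by
    have hm : Measurable fun z : Sample X N K => logLoss fstar z - logLoss f z :=
      (measurable_logLoss hfsm).sub (measurable_logLoss hfm)
    rw [integral_eq_integral_sum_mnlProb hfsm (fun x j => hβ.trans_le (hfs x j).1) hH hm.exp
      (C := Real.exp (2 * Real.log (1 / β)))]
    · have : ∀ p : X × Assortment N K, ∑ i, mnlProb p.2.1 (fstar p.1) i *
          Real.exp (logLoss fstar (p, i) - logLoss f (p, i)) = 1 := by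
        intro p
        rw [sum_mnlProb_mul, ← sum_exp_log_mnlProb p.2.1 fun j => hβ.trans_le (hf p.1 j).1]
        refine Finset.sum_congr rfl fun i hi => ?_
        have h1 := mnlProb_pos p.2.1 (fun j => hβ.trans_le (hfs p.1 j).1) hi
        nth_rw 1 [← Real.exp_log h1]
        rw [← Real.exp_add]
        congr 1
        simp only [logLoss]
        ring
      simp_rw [this]
      simp
    · intro z
      rw [Real.abs_exp]
      exact Real.exp_le_exp.2 ((le_abs_self _).trans (abs_logLoss_sub_le hβ hβ1 hf hfs z))

theorem strongCentral_one {F : Set (X → Fin N → ℝ)} (hFm : ∀ f ∈ F, Measurable f) {β : ℝ}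
    (hβ : 0 < β) (hβ1 : β ≤ 1) (hF : ∀ f ∈ F, ∀ x j, f x j ∈ Set.Icc β 1) (hfs : fstar ∈ F)
    (hH : FollowsMNL H fstar) : StrongCentral 1 F H := by
  refine ⟨fstar, hfs, fun f hf => ?_⟩
  have h := isLogRatio_logLoss_sub (hFm _ hfs) (hFm _ hf) hβ hβ1 (hF _ hf) (hF _ hfs) hH
  simp_rw [one_mul]
  exact ⟨h.integrable_exp, h.integral_exp.le⟩

end Model

/-! ### Empirical risk minimization over finite classes. -/

theorem exists_isERM {X : Type*} {N K : ℕ} {F : Set (X → Fin N → ℝ)}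
    (h : ∀ (n : ℕ) (D : Fin n → Sample X N K),
      ∃ g ∈ F, ∀ f ∈ F, ∑ k, logLoss g (D k) ≤ ∑ k, logLoss f (D k)) :
    ∃ alg : RegressionAlg X N K, IsERM F alg := by
  choose alg h1 h2 using h
  exact ⟨alg, fun n D => ⟨h1 n D, h2 n D⟩⟩

/-- Sample size `0` must be left out: division by zero gives the value `0` there. -/
theorem antitoneOn_div_natCast {A : ℝ} (hA : 0 ≤ A) :
    AntitoneOn (fun n : ℕ => A / n) (Set.Ici 1) := by
  intro m hm n _ hmn
  have hm0 : (0 : ℝ) < m := by exact_mod_cast (Set.mem_Ici.1 hm)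
  have : (m : ℝ) ≤ n := by exact_mod_cast hmn
  dsimp only
  gcongr

theorem finite_offlineOracle {X : Type*} [MeasurableSpace X] {N K : ℕ} (hK : 1 ≤ K) {β : ℝ}
    (hβ : 0 < β) (hβ1 : β < 1) {F : Set (X → Fin N → ℝ)} (hfin : F.Finite) (hne : F.Nonempty)
    (hFm : ∀ f ∈ F, Measurable f) (hF : ∀ f ∈ F, ∀ x i, f x i ∈ Set.Icc β 1)
    {alg : RegressionAlg X N K} (halg : IsERM F alg) {C : ℝ} (hC : 16 ≤ C) :
    OfflineOracle F alg (finiteErr C K β F.ncard) := by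
  have hcard : (1 : ℝ) ≤ F.ncard := by
    exact_mod_cast (Set.ncard_pos hfin).2 hne
  have hlogM : ∀ δ : ℝ, 0 < δ → δ < 1 → 0 ≤ Real.log (F.ncard / δ) := fun δ h0 h1 =>
    Real.log_nonneg (by rw [le_div_iff₀ h0]; linarith)
  have hm1 : (1 : ℝ) ≤ max 1 (Real.log (K / β)) := le_max_left _ _
  refine ⟨fun δ h0 h1 => antitoneOn_div_natCast ?_, ?_⟩
  · have := hlogM δ h0 h1
    positivity
  intro H _ fstar hfs hH n hn δ hδ hδ1
  set c : ℝ := max 5 (4 * (2 * Real.log (1 / β))) with hc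
  obtain ⟨G, hGm, hGp, hG⟩ := exists_event_finite_class (H := H) hfin.toFinset
    (by simpa using hne) (y := fun f z => logLoss fstar z - logLoss f z)
    (L := 2 * Real.log (1 / β)) (c := c)
    (fun f hf => isLogRatio_logLoss_sub (hFm _ hfs) (hFm _ (by simpa using hf)) hβ hβ1.le
      (hF _ (by simpa using hf)) (hF _ hfs) hH) (le_max_left _ _) (le_max_right _ _) hn hδ
  refine ⟨G, hGm, hGp, fun D hD => ?_⟩
  obtain ⟨hmem, hmin⟩ := halg n D
  have hR := isLogRatio_logLoss_sub (hFm _ hfs) (hFm _ hmem) hβ hβ1.le (hF _ hmem) (hF _ hfs) hH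
  have h1 := hG D hD (alg n D) (by simpa using hmem)
    (by rw [Finset.sum_sub_distrib]; exact sub_nonneg.2 (hmin fstar hfs))
  simp only [neg_sub] at h1
  refine ⟨hmem, hR.integrable.neg.congr (.of_forall fun z => neg_sub _ _), h1.trans ?_⟩
  rw [finiteErr, ← Set.ncard_eq_toFinset_card F hfin]
  refine div_le_div_of_nonneg_right ?_ (Nat.cast_nonneg n)
  -- Here `log (1/β)` is weakened to `log (K/β)`, the only place where `1 ≤ K` enters.
  have hcle : c ≤ 8 * max 1 (Real.log (K / β)) := by
    have h2 : Real.log (1 / β) ≤ Real.log (K / β) := by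
      have : (1 : ℝ) ≤ K := by exact_mod_cast hK
      apply Real.log_le_log (by positivity)
      gcongr
    refine max_le (by linarith) ?_
    have := le_max_right 1 (Real.log (K / β))
    linarith
  have h3 : 2 * c ≤ C * max 1 (Real.log (K / β)) := by nlinarith
  calc 2 * c * Real.log (F.ncard / δ) ≤
        (C * max 1 (Real.log (K / β))) * Real.log (F.ncard / δ) :=
        mul_le_mul_of_nonneg_right h3 (hlogM δ hδ hδ1)
    _ = _ := by ring

/-! ### The linear class. -/

section Linear

variable {N d : ℕ} (𝒳 : Set (Fin N → EuclideanSpace ℝ (Fin d))) (B : ℝ)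

/-- The member of the linear class with parameter `θ`. -/
def linearValue (θ : EuclideanSpace ℝ (Fin d)) (x : 𝒳) (i : Fin N) : ℝ :=
  Real.exp (inner ℝ θ (x.1 i) - B)

theorem mem_linearClass_iff {f : 𝒳 → Fin N → ℝ} :
    f ∈ linearClass 𝒳 B ↔ ∃ θ, ‖θ‖ ≤ B ∧ f = linearValue 𝒳 B θ := Iff.rfl

theorem measurable_uncurry_linearValue :
    Measurable fun q : EuclideanSpace ℝ (Fin d) × 𝒳 => linearValue 𝒳 B q.1 q.2 := by
  refine measurable_pi_lambda _ fun i => ?_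
  have h : Measurable fun q : EuclideanSpace ℝ (Fin d) × 𝒳 => q.2.1 i :=
    (measurable_pi_apply i).comp (measurable_subtype_coe.comp measurable_snd)
  have h' : Measurable fun q : EuclideanSpace ℝ (Fin d) × 𝒳 => inner ℝ q.1 (q.2.1 i) :=
    Measurable.inner measurable_fst h
  exact (h'.sub_const B).exp

theorem measurable_linearValue (θ : EuclideanSpace ℝ (Fin d)) :
    Measurable (linearValue 𝒳 B θ) := by
  have h : Measurable fun x : 𝒳 => (θ, x) := measurable_prodMk_left
  have h' := (measurable_uncurry_linearValue 𝒳 B).comp h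
  rw [Function.comp_def] at h'
  exact h'

theorem log_linearValue_combination (a b : EuclideanSpace ℝ (Fin d)) (t : ℝ) (x : 𝒳) (i : Fin N) :
    Real.log (linearValue 𝒳 B ((1 - t) • a + t • b) x i) =
      (1 - t) * Real.log (linearValue 𝒳 B a x i) + t * Real.log (linearValue 𝒳 B b x i) := by
  simp only [linearValue, Real.log_exp, inner_add_left, real_inner_smul_left]
  ring

theorem linearValue_pos (θ : EuclideanSpace ℝ (Fin d)) (x : 𝒳) (i : Fin N) :
    0 < linearValue 𝒳 B θ x i := Real.exp_pos _

variable {𝒳 B}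

theorem linearValue_mem_Icc (h𝒳 : ∀ x ∈ 𝒳, ∀ i, ‖x i‖ ≤ 1) {θ : EuclideanSpace ℝ (Fin d)}
    (hθ : ‖θ‖ ≤ B) (x : 𝒳) (i : Fin N) :
    linearValue 𝒳 B θ x i ∈ Set.Icc (Real.exp (-(2 * B))) 1 := by
  have h1 : |inner ℝ θ (x.1 i)| ≤ B :=
    (abs_real_inner_le_norm _ _).trans <| by
      calc ‖θ‖ * ‖x.1 i‖ ≤ B * 1 := by
            gcongr
            · exact (norm_nonneg _).trans hθ
            · exact h𝒳 _ x.2 i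
        _ = B := mul_one B
  rw [abs_le] at h1
  exact ⟨Real.exp_le_exp.2 (by linarith), Real.exp_le_one_iff.2 (by linarith)⟩

/-- Supplies the continuity for the compactness argument on every data set, including impossible
samples, where the loss is constantly `-Real.log 0 = 0`. -/
theorem continuous_logLoss_linearValue {K : ℕ} (z : Sample 𝒳 N K) :
    Continuous fun θ => logLoss (linearValue 𝒳 B θ) z := by
  have hc : ∀ j, Continuous fun θ => linearValue 𝒳 B θ z.1.1 j := fun j =>
    ((continuous_id.inner continuous_const).sub continuous_const).rexp
  by_cases hi : z.2 ∈ outcomes z.1.2.1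
  · have h : (fun θ => logLoss (linearValue 𝒳 B θ) z) = fun θ =>
        -(Fin.cases (motive := fun _ => ℝ) 0 (fun j => Real.log (linearValue 𝒳 B θ z.1.1 j)) z.2
        - Real.log (1 + ∑ j ∈ z.1.2.1, linearValue 𝒳 B θ z.1.1 j)) := by
      funext θ
      rw [logLoss, log_mnlProb _ (linearValue_pos 𝒳 B θ z.1.1) hi]
    rw [h]
    refine (Continuous.sub ?_ (Continuous.log (continuous_const.add
      (continuous_finsetSum _ fun j _ => hc j)) fun θ =>
        (one_add_sum_pos _ (linearValue_pos 𝒳 B θ z.1.1)).ne')).neg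
    generalize z.2 = i
    induction i using Fin.cases with
    | zero => exact continuous_const
    | succ j => exact (hc j).log fun θ => (linearValue_pos 𝒳 B θ z.1.1 j).ne'
  · simp only [logLoss, mnlProb_eq_zero _ hi]
    exact continuous_const

theorem exists_linear_minimizer {K n : ℕ} (hB : 0 ≤ B) (D : Fin n → Sample 𝒳 N K) :
    ∃ g ∈ linearClass 𝒳 B, ∀ f ∈ linearClass 𝒳 B,
      ∑ k, logLoss g (D k) ≤ ∑ k, logLoss f (D k) := by
  have hcont : Continuous fun θ => ∑ k, logLoss (linearValue 𝒳 B θ) (D k) :=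
    continuous_finsetSum _ fun k _ => continuous_logLoss_linearValue (D k)
  obtain ⟨θ, hθ, hmin⟩ := (isCompact_closedBall (0 : EuclideanSpace ℝ (Fin d)) B).exists_isMinOn
    (Metric.nonempty_closedBall.2 hB) hcont.continuousOn
  refine ⟨linearValue 𝒳 B θ, ⟨θ, mem_closedBall_zero_iff.1 hθ, rfl⟩, ?_⟩
  rintro f ⟨θ', hθ', rfl⟩
  exact hmin (mem_closedBall_zero_iff.2 hθ')

theorem linear_error_bound {d : ℕ} (hd : 1 ≤ d) {B δ l c : ℝ} (hδ : 0 < δ)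
    (hl : 1 ≤ l) (hc : c = max 5 (16 * B)) :
    8 * c * (2 * Real.log (2 / δ) + d * Real.log (520 * c ^ 2)) ≤
      3072 * (d * max 1 B * l * max 1 (Real.log B) * max 1 (Real.log (1 / δ))) := by
  have hd1 : (1 : ℝ) ≤ d := by exact_mod_cast hd
  set b := max 1 B with hb
  set p := max 1 (Real.log B) with hp
  set q := max 1 (Real.log (1 / δ)) with hq
  have hb1 : 1 ≤ b := le_max_left _ _
  have hp1 : 1 ≤ p := le_max_left _ _
  have hq1 : 1 ≤ q := le_max_left _ _
  have hc0 : 0 < c := hc ▸ lt_max_of_lt_left (by norm_num)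
  have hcb : c ≤ 16 * b := by
    rw [hc]
    refine max_le (by linarith) ?_
    have := le_max_right 1 B
    linarith
  have hlogb : Real.log b ≤ p := by
    rcases le_total B 1 with h | h
    · rw [hb, max_eq_left h, Real.log_one]; linarith
    · rw [hb, max_eq_right h]; exact le_max_right _ _
  have hlog2 : Real.log 2 ≤ 1 := by
    have := Real.log_two_lt_d9
    linarith
  have h1 : Real.log (520 * c ^ 2) ≤ 18 + 2 * p := by
    -- From `c ≤ 16 b`: `520 * 16 ^ 2 = 133120 ≤ 2 ^ 18`.
    calc Real.log (520 * c ^ 2) ≤ Real.log (2 ^ 18 * b ^ 2) := by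
          apply Real.log_le_log (by positivity)
          have : c ^ 2 ≤ (16 * b) ^ 2 := by gcongr
          nlinarith [sq_nonneg b]
      _ = 18 * Real.log 2 + 2 * Real.log b := by
          rw [Real.log_mul (by positivity) (by positivity), Real.log_pow, Real.log_pow]
          norm_num
      _ ≤ 18 + 2 * p := by linarith
  have h2 : Real.log (2 / δ) ≤ 2 * q := by
    rw [Real.log_div two_ne_zero hδ.ne']
    have h : Real.log (1 / δ) ≤ q := le_max_right _ _
    have h' : Real.log (1 / δ) = -Real.log δ := by rw [one_div, Real.log_inv]
    linarith
  have hdpq1 : 1 ≤ d * p := by nlinarith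
  have h3 : 2 * Real.log (2 / δ) + d * Real.log (520 * c ^ 2) ≤ 24 * (d * p * q) := by
    have e1 : q ≤ d * p * q := by nlinarith
    have e2 : d * p ≤ d * p * q := by nlinarith
    have e3 : (d : ℝ) * Real.log (520 * c ^ 2) ≤ d * (20 * p) := by
      gcongr; linarith
    linarith
  calc 8 * c * (2 * Real.log (2 / δ) + d * Real.log (520 * c ^ 2))
      ≤ 8 * c * (24 * (d * p * q)) := by gcongr
    _ ≤ 8 * (16 * b) * (24 * (d * p * q)) := by gcongr
    _ = 3072 * (d * b * 1 * p * q) := by ring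
    _ ≤ 3072 * (d * b * l * p * q) := by gcongr

theorem measurable_linearValue_sample {K : ℕ} :
    Measurable fun q : EuclideanSpace ℝ (Fin d) × Sample 𝒳 N K =>
      linearValue 𝒳 B q.1 q.2.1.1 := by
  have h : Measurable fun q : EuclideanSpace ℝ (Fin d) × Sample 𝒳 N K => (q.1, q.2.1.1) :=
    measurable_fst.prodMk (measurable_fst.comp (measurable_fst.comp measurable_snd))
  have h' := (measurable_uncurry_linearValue 𝒳 B).comp h
  rw [Function.comp_def] at h'
  exact h'

theorem measurable_uncurry_logLoss_linearValue {K : ℕ} :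
    Measurable fun q : EuclideanSpace ℝ (Fin d) × Sample 𝒳 N K =>
      logLoss (linearValue 𝒳 B q.1) q.2 := by
  have h3 : Measurable fun q : EuclideanSpace ℝ (Fin d) × Sample 𝒳 N K =>
      ((linearValue 𝒳 B q.1 q.2.1.1, q.2.1.2), q.2.2) :=
    (measurable_linearValue_sample.prodMk
      (measurable_snd.comp (measurable_fst.comp measurable_snd))).prodMk
      (measurable_snd.comp measurable_snd)
  have h4 := measurable_mnlProb.comp h3
  rw [Function.comp_def] at h4
  exact h4.log.neg

theorem measurable_uncurry_logLoss_linearValue_sub {K : ℕ} (θs : EuclideanSpace ℝ (Fin d)) :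
    Measurable (Function.uncurry fun (θ : EuclideanSpace ℝ (Fin d))
      (z : Sample 𝒳 N K) => logLoss (linearValue 𝒳 B θs) z - logLoss (linearValue 𝒳 B θ) z) := by
  have h := measurable_logLoss (K := K) (measurable_linearValue 𝒳 B θs)
  exact (h.comp measurable_snd).sub measurable_uncurry_logLoss_linearValue

theorem logLoss_linearValue_combination_le {K : ℕ} (θs a b : EuclideanSpace ℝ (Fin d)) {t : ℝ}
    (ht : 0 ≤ t) (ht1 : t ≤ 1) (z : Sample 𝒳 N K) :
    (1 - t) * (logLoss (linearValue 𝒳 B θs) z - logLoss (linearValue 𝒳 B a) z) +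
        t * (logLoss (linearValue 𝒳 B θs) z - logLoss (linearValue 𝒳 B b) z) ≤
      logLoss (linearValue 𝒳 B θs) z -
        logLoss (linearValue 𝒳 B ((1 - t) • a + t • b)) z := by
  have := log_mnlProb_geometricMixture_ge z.1.2.1 (linearValue_pos 𝒳 B a z.1.1)
    (linearValue_pos 𝒳 B b z.1.1) (linearValue_pos 𝒳 B _ z.1.1) ht ht1
    (log_linearValue_combination 𝒳 B a b t z.1.1) z.2
  simp only [logLoss]
  linarith

/-- The geometric mixture inequality holds conditionally on each `(x, S)` and is then integrated. -/
theorem risk_linearValue_combination_ge {K : ℕ} {H : Measure (Sample 𝒳 N K)}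
    [IsProbabilityMeasure H] {θs a b : EuclideanSpace ℝ (Fin d)}
    (hH : FollowsMNL H (linearValue 𝒳 B θs)) {β c : ℝ} (hβ0 : 0 < β) (hβ1 : β ≤ 1)
    (hs : ∀ x i, linearValue 𝒳 B θs x i ∈ Set.Icc β 1)
    (ha : ∀ x i, linearValue 𝒳 B a x i ∈ Set.Icc β 1)
    (hb : ∀ x i, linearValue 𝒳 B b x i ∈ Set.Icc β 1)
    (hm : ∀ x i, linearValue 𝒳 B ((1 - 1 / (10 * c)) • a + (1 / (10 * c)) • b) x i ∈ Set.Icc β 1)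
    (hc5 : 5 ≤ c) (hcL : 4 * (2 * Real.log (1 / β)) ≤ c) :
    (1 / 2) * (∫ z, -(logLoss (linearValue 𝒳 B θs) z - logLoss (linearValue 𝒳 B a) z) ∂H) -
        (1 / 2) * (∫ z, -(logLoss (linearValue 𝒳 B θs) z - logLoss (linearValue 𝒳 B b) z) ∂H) ≤
      ∫ z, -(logLoss (linearValue 𝒳 B θs) z -
        logLoss (linearValue 𝒳 B ((1 - 1 / (10 * c)) • a + (1 / (10 * c)) • b)) z) ∂H := by
  have hratio : ∀ θ, (∀ x i, linearValue 𝒳 B θ x i ∈ Set.Icc β 1) →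
      IsLogRatio H (2 * Real.log (1 / β)) fun z =>
        logLoss (linearValue 𝒳 B θs) z - logLoss (linearValue 𝒳 B θ) z := fun θ hθ =>
    isLogRatio_logLoss_sub (measurable_linearValue 𝒳 B θs) (measurable_linearValue 𝒳 B θ) hβ0 hβ1
      hθ hs hH
  have hRa := hratio a ha
  have hRb := hratio b hb
  have hRm := hratio _ hm
  have hi : ∀ {y : Sample 𝒳 N K → ℝ} {L : ℝ}, IsLogRatio H L y →
      Integrable (fun z => (1 / 2) * -y z) H := fun h => h.integrable.neg.const_mul _
  rw [← integral_const_mul, ← integral_const_mul,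
    ← integral_sub (hi hRa) (hi hRb)]
  refine integral_le_of_sum_mnlProb_le (measurable_linearValue 𝒳 B θs)
    (linearValue_pos 𝒳 B θs) hH ((hRa.measurable.neg.const_mul _).sub
      (hRb.measurable.neg.const_mul _)) hRm.measurable.neg (C := 2 * (2 * Real.log (1 / β)))
    (C' := 2 * Real.log (1 / β)) ?_ ?_ ?_
  · intro z
    have h1 := abs_le.1 (hRa.abs_le z)
    have h2 := abs_le.1 (hRb.abs_le z)
    rw [abs_le]
    constructor <;> linarith [h1.1, h1.2, h2.1, h2.2]
  · intro z
    rw [abs_neg]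
    exact hRm.abs_le z
  · intro p
    have := sum_mnlProb_mul_geometricMixture_ge p.2.1 (linearValue_pos 𝒳 B θs p.1) hβ0 hβ1
      (ha p.1) (hb p.1) (linearValue_pos 𝒳 B _ p.1) hc5 hcL
      (log_linearValue_combination 𝒳 B a b _ p.1)
    simpa only [logLoss, neg_sub, sub_neg_eq_add, neg_add_eq_sub] using this

theorem linear_offlineOracle {K : ℕ} (hB : 0 < B) (h𝒳 : ∀ x ∈ 𝒳, ∀ i, ‖x i‖ ≤ 1)
    {alg : RegressionAlg 𝒳 N K} (halg : IsERM (linearClass 𝒳 B) alg) :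
    OfflineOracle (linearClass 𝒳 B) alg (linearErr 3072 d K B) := by
  refine ⟨fun δ h0 h1 => antitoneOn_div_natCast (by positivity), ?_⟩
  rintro H _ _ ⟨θs, hθs, rfl⟩ hH n hn δ hδ hδ1
  change FollowsMNL H (linearValue 𝒳 B θs) at hH
  have hn0 : (0 : ℝ) < n := by exact_mod_cast hn
  -- For `d = 0` the stated error is `0`, but the class has a single member and the excess loss
  -- vanishes. For `d ≥ 1` the term `log (2/δ)` can be absorbed into the product with `d`.
  rcases Nat.eq_zero_or_pos d with rfl | hd
  · refine ⟨Set.univ, MeasurableSet.univ, by simp [hδ.le], fun D _ => ?_⟩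
    have hmem := (halg n D).1
    obtain ⟨θ, -, hθ⟩ := id hmem
    refine ⟨hmem, ?_⟩
    rw [hθ, Subsingleton.elim θ θs]
    simp [linearErr]
  set β := Real.exp (-(2 * B)) with hβ
  have hβ0 : 0 < β := Real.exp_pos _
  have hβ1 : β ≤ 1 := Real.exp_le_one_iff.2 (by linarith)
  have hlogβ : Real.log (1 / β) = 2 * B := by rw [hβ, one_div, Real.log_inv, Real.log_exp, neg_neg]
  -- Values lie in `[exp (-2B), 1]`, so the log ratios are bounded by `L = 4B` and `4L = 16B`.
  set c : ℝ := max 5 (16 * B) with hc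
  have hc5 : 5 ≤ c := le_max_left _ _
  have hcL : 4 * (2 * Real.log (1 / β)) ≤ c := by
    rw [hlogβ]
    have : 16 * B ≤ c := le_max_right _ _
    linarith
  set Θ := Metric.closedBall (0 : EuclideanSpace ℝ (Fin d)) B
  have hIcc : ∀ θ ∈ Θ, ∀ x i, linearValue 𝒳 B θ x i ∈ Set.Icc β 1 := fun θ hθ =>
    linearValue_mem_Icc h𝒳 (mem_closedBall_zero_iff.1 hθ)
  have hθsΘ : θs ∈ Θ := mem_closedBall_zero_iff.2 hθs
  have hratio : ∀ θ ∈ Θ, IsLogRatio H (2 * Real.log (1 / β)) fun z =>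
      logLoss (linearValue 𝒳 B θs) z - logLoss (linearValue 𝒳 B θ) z := fun θ hθ =>
    isLogRatio_logLoss_sub (measurable_linearValue 𝒳 B θs) (measurable_linearValue 𝒳 B θ) hβ0 hβ1
      (hIcc θ hθ) (hIcc θs hθsΘ) hH
  have hcomb : ∀ a ∈ Θ, ∀ b ∈ Θ, (1 - 1 / (10 * c)) • a + (1 / (10 * c)) • b ∈ Θ := by
    intro a ha b hb
    refine convex_closedBall _ _ ha hb (sub_nonneg.2 ?_) (by positivity) (by ring)
    rw [div_le_one (by positivity)]; linarith
  obtain ⟨G, hGm, hGp, hG⟩ := exists_event_concave_class (H := H)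
    (volume : Measure (EuclideanSpace ℝ (Fin d))) (Θ := Θ) measurableSet_closedBall
    (convex_closedBall _ _) (Metric.measure_closedBall_pos _ _ hB).ne'
    measure_closedBall_lt_top.ne (measurable_uncurry_logLoss_linearValue_sub θs) hratio hc5 hcL hθsΘ
    (fun z => sub_self _)
    (fun a _ b _ t ht ht1 z => logLoss_linearValue_combination_le θs a b ht ht1 z)
    (fun a ha b hb => risk_linearValue_combination_ge hH hβ0 hβ1 (hIcc θs hθsΘ) (hIcc a ha)
      (hIcc b hb) (hIcc _ (hcomb a ha b hb)) hc5 hcL) n hδ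
  refine ⟨G, hGm, hGp, fun D hD => ?_⟩
  obtain ⟨hmem, hmin⟩ := halg n D
  refine ⟨hmem, ?_⟩
  obtain ⟨θ, hθ, hθeq⟩ := (mem_linearClass_iff 𝒳 B).1 hmem
  have hθΘ : θ ∈ Θ := mem_closedBall_zero_iff.2 hθ
  have hsum : 0 ≤ ∑ k,
      (logLoss (linearValue 𝒳 B θs) (D k) - logLoss (linearValue 𝒳 B θ) (D k)) := by
    rw [Finset.sum_sub_distrib, ← hθeq]
    exact sub_nonneg.2 (hmin _ ⟨θs, hθs, rfl⟩)
  have h1 := hG D hD θ hθΘ hsum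
  rw [finrank_euclideanSpace_fin] at h1
  have h2 := h1.trans (linear_error_bound hd hδ (le_max_left 1 (Real.log K)) hc)
  rw [hθeq]
  change Integrable (fun z => logLoss (linearValue 𝒳 B θ) z - logLoss (linearValue 𝒳 B θs) z) H ∧
    ∫ z, (logLoss (linearValue 𝒳 B θ) z - logLoss (linearValue 𝒳 B θs) z) ∂H ≤ _
  simp only [neg_sub] at h2
  refine ⟨(hratio θ hθΘ).integrable.neg.congr (.of_forall fun z => neg_sub _ _), ?_⟩
  rw [linearErr, le_div_iff₀ hn0]
  linarith

end Linear

end MNL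

end

theorem mainTheorem10 :
    ∃ C : ℝ, 0 < C ∧
      -- finite classes with values in `[β, 1]^N`
      (∀ (X : Type*) [MeasurableSpace X] (N K : ℕ), 1 ≤ K → K ≤ N →
        ∀ β : ℝ, 0 < β → β < 1 →
        ∀ F : Set (X → Fin N → ℝ), F.Finite → F.Nonempty →
          (∀ f ∈ F, Measurable f) → (∀ f ∈ F, ∀ x i, f x i ∈ Set.Icc β 1) →
          (∃ alg : MNL.RegressionAlg X N K, MNL.IsERM F alg) ∧
          (∀ alg : MNL.RegressionAlg X N K, MNL.IsERM F alg →
            MNL.OfflineOracle F alg (MNL.finiteErr C K β F.ncard)) ∧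
          (∀ H : MeasureTheory.Measure (MNL.Sample X N K), MeasureTheory.IsProbabilityMeasure H →
            ∀ fstar ∈ F, MNL.FollowsMNL H fstar → MNL.StrongCentral 1 F H)) ∧
      -- the linear class
      (∀ (N K d : ℕ), 1 ≤ K → K ≤ N → ∀ B : ℝ, 0 < B →
        ∀ 𝒳 : Set (Fin N → EuclideanSpace ℝ (Fin d)), (∀ x ∈ 𝒳, ∀ i, ‖x i‖ ≤ 1) →
          (∃ alg : MNL.RegressionAlg 𝒳 N K, MNL.IsERM (MNL.linearClass 𝒳 B) alg) ∧
          (∀ alg : MNL.RegressionAlg 𝒳 N K, MNL.IsERM (MNL.linearClass 𝒳 B) alg →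
            MNL.OfflineOracle (MNL.linearClass 𝒳 B) alg (MNL.linearErr C d K B)) ∧
          (∀ H : MeasureTheory.Measure (MNL.Sample 𝒳 N K), MeasureTheory.IsProbabilityMeasure H →
            ∀ fstar ∈ MNL.linearClass 𝒳 B, MNL.FollowsMNL H fstar →
              MNL.StrongCentral 1 (MNL.linearClass 𝒳 B) H)) := by
  -- The linear class dictates `3072 = 8 * 16 * 24`; the finite class needs only `16`.
  refine ⟨3072, by norm_num, ?_, ?_⟩
  · intro X _ N K hK _ β hβ hβ1 F hfin hne hFm hF
    refine ⟨MNL.exists_isERM fun n D => ?_, fun alg halg =>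
      MNL.finite_offlineOracle hK hβ hβ1 hfin hne hFm hF halg (by norm_num),
      fun H _ fstar hfs hH => MNL.strongCentral_one hFm hβ hβ1.le hF hfs hH⟩
    exact Set.exists_min_image F (fun f => ∑ k, MNL.logLoss f (D k)) hfin hne
  · intro N K d _ _ B hB 𝒳 h𝒳
    refine ⟨MNL.exists_isERM fun n D => MNL.exists_linear_minimizer hB.le D, fun alg halg =>
      MNL.linear_offlineOracle hB h𝒳 halg, fun H _ fstar hfs hH => ?_⟩
    refine MNL.strongCentral_one ?_ (Real.exp_pos (-(2 * B)))
      (Real.exp_le_one_iff.2 (by linarith)) ?_ hfs hH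
    · rintro f ⟨θ, -, rfl⟩
      exact MNL.measurable_linearValue 𝒳 B θ
    · rintro f ⟨θ, hθ, rfl⟩
      exact MNL.linearValue_mem_Icc h𝒳 hθ
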